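/- **Theorem 10.5.** Let $\mathbb T$ be the unit circle, $j=e^{2\pi i/3}$, and $F_n=(e^{2\pi i\,ab/n})_{0\le a,b<n}$ the Fourier matrix. A complex Hadamard matrix is a square complex matrix with entries in $\mathbb T$ and pairwise orthogonal rows; two square complex matrices of the same size are equivalent if one passes from one to the other by permuting rows and columns and multiplying rows and columns by elements of $\mathbb T$. For $u,v\in\mathbb T^6$, the scalar product $\langle u,v\rangle=\sum_{k=1}^6u_k\bar v_k$ is called binary if its six terms $u_k\bar v_k$ are, up to order, $x,-x,y,-y,z,-z$ for some $x,y,z\in\mathbb T$, and ternary if they are, up to order, $x,jx,j^2x,y,jy,j^2y$ for some $x,y\in\mathbb T$. For $h\in M_n(\mathbb C)$, $k\in M_m(\mathbb C)$ and $l\in M_{m\times n}(\mathbb T)$, the Diţă deformation of $h\otimes k$ with parameters $l$ is $h\otimes_l k=(h_{ij}\,l_{aj}\,k_{ab})_{ia,jb}$, the pairs $ia$ and $jb$ being ordered lexicographically. For $r,s\in\mathbb T$ put $$F_{23}^{rs}=F_2\otimes_{\begin{pmatrix}1&1\\1&r\\1&s\end{pmatrix}}F_3,\qquad F_{32}^{rs}=F_3\otimes_{\begin{pmatrix}1&1&1\\1&r&s\end{pmatrix}}F_2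 .$$ For every $h\in M_6(\mathbb C)$ the following are equivalent: 1. $h$ is a complex Hadamard matrix, each of the $15$ scalar products between two distinct rows of $h$ is binary or ternary, at least one of them is binary, and at least one of them is ternary (a scalar product that is both counts as both); 2. $h$ is equivalent to $F_{23}^{rs}$ or to $F_{32}^{rs}$ for some $r,s\in\mathbb T$. -/

import Mathlib

noncomputable section

namespace ComplexHadamard

/-- A complex Hadamard matrix: a square matrix whose entries have modulus one and whose rows
are pairwise orthogonal. -/
def IsHadamard {n : Type*} [Fintype n] (h : Matrix n n ℂ) : Prop :=
  (∀ i k, ‖h i k‖ = 1) ∧ ∀ i j, i ≠ j → ∑ k, h i k * star (h j k) = 0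

/-- Equivalence of square matrices: one passes from `h` to `h'` by permuting the rows and the
columns and multiplying the rows and the columns by complex numbers of modulus one.
Transposition is not allowed. -/
def Equivalent {n : Type*} (h h' : Matrix n n ℂ) : Prop :=
  ∃ (σ τ : Equiv.Perm n) (a b : n → Circle),
    ∀ i k, h' i k = (a i : ℂ) * (b k : ℂ) * h (σ i) (τ k)

/-- The primitive cube root of unity `j = e^{2πi/3}`. -/
def cubeRoot : ℂ := Complex.exp (2 * Real.pi * Complex.I / 3)

/-- The scalar product of `u` and `v`, regarded as the formal sum of its six terms
`u k * conj (v k)`, is binary: up to the order of the terms it is `x - x + y - y + z - z`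
with `x, y, z` on the unit circle. -/
def IsBinary (u v : Fin 6 → ℂ) : Prop :=
  ∃ (σ : Equiv.Perm (Fin 6)) (x y z : Circle),
    (fun k => u (σ k) * star (v (σ k))) = ![(x : ℂ), -x, y, -y, z, -z]

/-- The scalar product of `u` and `v`, regarded as the formal sum of its six terms
`u k * conj (v k)`, is ternary: up to the order of the terms it is
`x + jx + j²x + y + jy + j²y` with `x, y` on the unit circle. -/
def IsTernary (u v : Fin 6 → ℂ) : Prop :=
  ∃ (σ : Equiv.Perm (Fin 6)) (x y : Circle),
    (fun k => u (σ k) * star (v (σ k))) =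
      ![(x : ℂ), cubeRoot * x, cubeRoot ^ 2 * x, y, cubeRoot * y, cubeRoot ^ 2 * y]

/-- The Fourier matrix `F_n`, with rows and columns numbered from `0`. -/
def fourierMatrix (n : ℕ) : Matrix (Fin n) (Fin n) ℂ :=
  Matrix.of fun i k => Complex.exp (2 * Real.pi * Complex.I / n) ^ ((i : ℕ) * (k : ℕ))

/-- The Diţă deformation `h ⊗_l k` of the tensor product `h ⊗ k`, with matrix of parameters `l`
over the unit circle: its entry in row `(i, a)` and column `(j, b)` is `h i j * l a j * k a b`. -/
def ditaDeformation {n m : Type*} (h : Matrix n n ℂ) (l : Matrix m n Circle)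
    (k : Matrix m m ℂ) : Matrix (n × m) (n × m) ℂ :=
  Matrix.of fun p q => h p.1 q.1 * (l p.2 q.1 : ℂ) * k p.2 q.2

/-- The Diţă deformation `F_{23}^{rs}` of `F_2 ⊗ F_3`, with pairs of indices put in
lexicographic order. -/
def F23 (r s : Circle) : Matrix (Fin 6) (Fin 6) ℂ :=
  Matrix.reindex (finProdFinEquiv (m := 2) (n := 3)) (finProdFinEquiv (m := 2) (n := 3))
    (ditaDeformation (fourierMatrix 2) !![1, 1; 1, r; 1, s] (fourierMatrix 3))

/-- The Diţă deformation `F_{32}^{rs}` of `F_3 ⊗ F_2`, with pairs of indices put in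
lexicographic order. -/
def F32 (r s : Circle) : Matrix (Fin 6) (Fin 6) ℂ :=
  Matrix.reindex (finProdFinEquiv (m := 3) (n := 2)) (finProdFinEquiv (m := 3) (n := 2))
    (ditaDeformation (fourierMatrix 3) !![1, 1, 1; 1, r, s] (fourierMatrix 2))

end ComplexHadamard

end

namespace ComplexHadamard

/-! The converse implication is a computation with the explicit entries. The direct one has two
stages.

Combinatorial stage: two rows with a ternary product give, after reordering columns, a quotient
proportional to `(1, ω, ω², β, βω, βω²)`. Let `s` be the quotient of the first of these rows by any
third row. Both `s` and its quotient by that vector have one of finitely many binary or ternary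
patterns, so each pair of patterns is a system of multiplicative equations, that is, of integral
linear forms up to roots of unity. Solving all systems (`all_checkPattern`) shows that the three
rows contain a copy of `F_3` or that `s` satisfies one of five exceptional sets of relations. If all
four remaining rows were exceptional, two columns would not be orthogonal
(`exists_fourier_submatrix`).

Analytic stage: put the copy of `F_3` in the upper left corner of a dephased matrix. Since three
unimodular numbers of sum zero are proportional to the cube roots of unity, rows 1, 2 and columns 1,
2 depend on four parameters `β, γ, δ, ε` (`IsNormal`). Orthogonality to the first three rows gives
the Fourier transform of the last three entries of each lower row; unimodularity of these entries
then imposes one relation per row (`fourier_autocorrelation`). The three relations form a circulant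
system `T d = 0` with `d = (β̄, βγ̄, γ)` and `T` built from the transform of `(1, δ, ε)`. By
`circulant_kernel`, either `T = 0`, which gives `F23`, or `d` is constant, which gives `F32`, or `T`
and `d` are geometric progressions. In the last case all entries are cube roots of unity, and a
binary product is impossible. -/

/-! ### Integral linear forms, elimination, and the finite search -/

/-- The value `∏ eᵢ ^ fᵢ` of the integral linear form `f` at a list `e` of elements of a group. -/
def evalForm {G : Type*} [CommGroup G] : List ℤ → List G → G
  | [], _ => 1
  | _ :: _, [] => 1
  | a :: f, g :: e => g ^ a * evalForm f e

/-- The combination `f + k • g` of two linear forms, of possibly different lengths. -/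
def combineForm (k : ℤ) : List ℤ → List ℤ → List ℤ
  | f, [] => f
  | [], b :: g => k * b :: combineForm k [] g
  | a :: f, b :: g => (a + k * b) :: combineForm k f g

/-- The coefficient of `f` at the first place where the form `r` has coefficient `1` or `-1`,
times the coefficient of `r` there. -/
def pivotCoeff : List ℤ → List ℤ → ℤ
  | a :: r, b :: f => if a = 1 then b else if a = -1 then -b else pivotCoeff r f
  | _, _ => 0

/-- Elimination of a variable from the forms of `S` with the help of the relation `r`. The first
variable is never eliminated. -/
def eliminate (r : List ℤ) (S : List (List ℤ)) : List (List ℤ) :=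
  S.map fun f => if pivotCoeff r.tail f.tail = 0 then f
    else combineForm (-pivotCoeff r.tail f.tail) f r

/-- The systems of forms obtained from `S` by imposing a relation. The first variable stands
for a root of unity of order `36`. -/
def impose (S : List (List ℤ)) : List ℤ → List (List (List ℤ))
  | [] => [S]
  | c :: f =>
    if f.all (· = 0) then (if c % 36 = 0 then [S] else [])
    else if f.any fun a => a = 1 || a = -1 then [eliminate (c :: f) S]
    else
      let g := f.foldl (fun n a => Nat.gcd n a.natAbs) 0
      let f' := f.map (· / (g : ℤ))
      if (c / (g : ℤ) :: f').map ((g : ℤ) * ·) = c :: f ∧ 36 % g = 0 ∧ g ≠ 0 then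
        -- Extracting a `g`-th root leaves a root of unity of order dividing `g`, hence `g`
        -- branches. The order 36 leaves room for square and cube roots of sixth roots of unity.
        (List.range g).map fun (m : ℕ) => eliminate ((c / (g : ℤ) + (m : ℤ) * (36 / g : ℕ)) :: f') S
      -- Dropping the relation is sound: it only makes the final check harder to pass.
      else [S]

/-- In a system of forms `β, s₀, …, s₅`, the form `s_b - s_a` plus a multiple of the first variable
and a multiple of `β`. -/
def relation (S : List (List ℤ)) (p : Fin 6 × Fin 6 × ℤ × ℤ) : List ℤ :=
  let d := combineForm (-1) (S.getD (p.2.1 + 1) []) (S.getD (p.1 + 1) [])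
  let d := if p.2.2.2 = 0 then d else combineForm p.2.2.2 d (S.getD 0 [])
  if p.2.2.1 = 0 then d else combineForm 1 d [p.2.2.1]

/-- Whether the form is a multiple of `36` in the first variable alone. -/
def isTrivialForm : List ℤ → Bool
  | [] => true
  | c :: f => f.all (· = 0) && c % 36 = 0

/-- The systems of forms obtained from `S` by imposing a list of relations. -/
def imposeAll : List (Fin 6 × Fin 6 × ℤ × ℤ) → List (List ℤ) → List (List (List ℤ))
  | [], S => [S]
  | r :: rs, S => (impose S (relation S r)).flatMap (imposeAll rs)

/-- A way of being binary or ternary: representatives `0, p, q` of the classes of positions, and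
for each position its class and an exponent of a root of unity of order `36`. -/
structure Pattern where
  p : Fin 6
  q : Fin 6
  entry : List (Fin 6 × ℤ)

/-- The pattern of a binary scalar product, whose terms are opposite in the pairs of `m`. -/
def binaryPattern (m : (Fin 6 × Fin 6) × (Fin 6 × Fin 6) × (Fin 6 × Fin 6)) : Pattern where
  p := m.2.1.1
  q := m.2.2.1
  entry := (List.finRange 6).map fun k =>
    if k = m.1.2 then (0, 18) else if k = m.2.1.2 then (m.2.1.1, 18)
    -- The last alternative concerns the representatives, which refer to themselves; `m.1.1` is
    -- always `0`.
    else if k = m.2.2.2 then (m.2.2.1, 18) else (k, 0)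

/-- The pattern of a ternary scalar product, whose terms in the two triples of `m` are in geometric
progression. -/
def ternaryPattern (m : (Fin 6 × Fin 6) × (Fin 6 × Fin 6 × Fin 6)) (e : ℤ × ℤ) : Pattern where
  p := m.2.1
  q := m.2.1
  entry := (List.finRange 6).map fun k =>
    -- The exponents 12 and 24 of `e` choose the orientation of each triple; the third term gets the
    -- inverse root of unity.
    if k = m.1.1 then (0, e.1) else if k = m.1.2 then (0, 36 - e.1)
    else if k = m.2.2.1 then (m.2.1, e.2) else if k = m.2.2.2 then (m.2.1, 36 - e.2) else (k, 0)

/-- The partitions of the six positions into pairs. -/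
def matchings : List ((Fin 6 × Fin 6) × (Fin 6 × Fin 6) × (Fin 6 × Fin 6)) :=
  [((0, 1), (2, 3), (4, 5)), ((0, 1), (2, 4), (3, 5)), ((0, 1), (2, 5), (3, 4)),
    ((0, 2), (1, 3), (4, 5)), ((0, 2), (1, 4), (3, 5)), ((0, 2), (1, 5), (3, 4)),
    ((0, 3), (1, 2), (4, 5)), ((0, 3), (1, 4), (2, 5)), ((0, 3), (1, 5), (2, 4)),
    ((0, 4), (1, 2), (3, 5)), ((0, 4), (1, 3), (2, 5)), ((0, 4), (1, 5), (2, 3)),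
    ((0, 5), (1, 2), (3, 4)), ((0, 5), (1, 3), (2, 4)), ((0, 5), (1, 4), (2, 3))]

/-- The partitions of the six positions into triples, one of which contains `0`. -/
def splittings : List ((Fin 6 × Fin 6) × (Fin 6 × Fin 6 × Fin 6)) :=
  [((1, 2), (3, 4, 5)), ((1, 3), (2, 4, 5)), ((1, 4), (2, 3, 5)), ((1, 5), (2, 3, 4)),
    ((2, 3), (1, 4, 5)), ((2, 4), (1, 3, 5)), ((2, 5), (1, 3, 4)), ((3, 4), (1, 2, 5)),
    ((3, 5), (1, 2, 4)), ((4, 5), (1, 2, 3))]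

/-- The ways of being binary or ternary. -/
def patterns : List Pattern :=
  matchings.map binaryPattern ++ splittings.flatMap fun m =>
    [(12, 12), (12, 24), (24, 12), (24, 24)].map (ternaryPattern m)

/-- The generic system of forms `β, s₀, …, s₅` with the given pattern and `s₀ = 0`, in the variables
`ζ, β, s p, s q`. -/
def Pattern.forms (o : Pattern) : List (List ℤ) :=
  [0, 1] :: o.entry.map fun x =>
    if x.1 = 0 then [x.2] else if x.1 = o.p then [x.2, 0, 1] else [x.2, 0, 0, 1]

/-- The relations expressing that the quotient of `s` by `(1, ω, ω², β, βω, βω²)` has the given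
pattern, where `ω = ζ ^ 12`. -/
def Pattern.relations (o : Pattern) : List (Fin 6 × Fin 6 × ℤ × ℤ) :=
  ((List.finRange 6).zip o.entry).filterMap fun x =>
    if x.1 = x.2.1 then none
    else some (x.1, x.2.1, x.2.2 + 12 * ((x.1 : ℕ) % 3 : ℕ) - 12 * ((x.2.1 : ℕ) % 3 : ℕ),
      (if (x.1 : ℕ) < 3 then 0 else 1) - (if (x.2.1 : ℕ) < 3 then 0 else 1))

/-- Whether the relations hold in the system of forms. -/
def holdAll (S : List (List ℤ)) (l : List (Fin 6 × Fin 6 × ℤ × ℤ)) : Bool :=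
  l.all fun r => isTrivialForm (relation S r)

/-- The relations expressing that `s b = ω ^ (2 * e) * s a` and `t b = ω ^ e * t a`
where `t = (1, ω, ω², β, βω, βω²)` and `ω = ζ ^ 12`. -/
def fourierRelations (a b : Fin 6) (e : ℤ) : List (Fin 6 × Fin 6 × ℤ × ℤ) :=
  -- With equal indices `s` cancels, and the relation bears on `β` alone.
  [(b, b, 12 * e + 12 * ((a : ℕ) % 3 : ℕ) - 12 * ((b : ℕ) % 3 : ℕ),
      (if (a : ℕ) < 3 then 0 else 1) - (if (b : ℕ) < 3 then 0 else 1)),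
    (b, a, 24 * e, 0)]

/-- Whether the system of forms satisfies one of the five sets of relations that are dealt with
separately, as they do not provide a Fourier submatrix. -/
def isExceptional (S : List (List ℤ)) : Bool :=
  holdAll S [(1, 0, 0, 0), (2, 0, 0, 0), (3, 0, 18, 0)] ||
  holdAll S [(1, 0, 12, 0), (2, 0, 24, 0), (3, 0, 18, 1)] ||
  holdAll S [(0, 0, 0, 1), (3, 0, 18, 0)] ||
  holdAll S [(0, 0, 24, 1), (3, 1, 18, 0)] ||
  holdAll S [(0, 0, 12, 1), (3, 2, 18, 0)]

/-- Whether there is a Fourier submatrix. -/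
def hasFourier (S : List (List ℤ)) : Bool :=
  (List.finRange 6).any fun a => (List.finRange 6).any fun b =>
    a < b && holdAll S (fourierRelations a b 1) && (List.finRange 6).any fun c =>
      a < c && holdAll S (fourierRelations a c 2)

/-- Whether each refinement of the pattern is exceptional or has a Fourier submatrix. -/
def checkPattern (o : Pattern) : Bool :=
  patterns.all fun o' => (imposeAll o'.relations o.forms).all fun S =>
    isExceptional S || hasFourier S

/-! ### Soundness of the elimination -/

section Forms

variable {G : Type*} [CommGroup G]

@[simp] theorem evalForm_nil (e : List G) : evalForm [] e = 1 := by
  simp [evalForm]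

@[simp] theorem evalForm_nil_right (f : List ℤ) : evalForm f ([] : List G) = 1 := by
  cases f <;> simp [evalForm]

@[simp] theorem evalForm_cons (a : ℤ) (f : List ℤ) (g : G) (e : List G) :
    evalForm (a :: f) (g :: e) = g ^ a * evalForm f e := rfl

theorem evalForm_combineForm (k : ℤ) (f g : List ℤ) (e : List G) :
    evalForm (combineForm k f g) e = evalForm f e * evalForm g e ^ k := by
  induction g generalizing f e with
  | nil => cases f <;> simp [combineForm]
  | cons b g ih =>
    cases e with
    | nil => simp
    | cons x e =>
      cases f with
      | nil =>
        simp only [combineForm, evalForm_cons, ih, evalForm_nil, one_mul, mul_zpow]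
        rw [mul_comm k b, zpow_mul]
      | cons a f =>
        simp only [combineForm, evalForm_cons, ih, mul_zpow, zpow_add]
        rw [mul_comm k b, zpow_mul]
        exact mul_mul_mul_comm _ _ _ _

theorem evalForm_of_forall_eq_zero {f : List ℤ} (hf : ∀ a ∈ f, a = 0) (e : List G) :
    evalForm f e = 1 := by
  induction f generalizing e with
  | nil => simp
  | cons a f ih =>
    cases e with
    | nil => simp
    | cons x e =>
      rw [evalForm_cons, ih (fun b hb => hf b (List.mem_cons_of_mem _ hb)),
        hf a List.mem_cons_self, zpow_zero, mul_one]

theorem evalForm_map_mul (k : ℤ) (f : List ℤ) (e : List G) :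
    evalForm (f.map (k * ·)) e = evalForm f e ^ k := by
  induction f generalizing e with
  | nil => simp
  | cons a f ih =>
    cases e with
    | nil => simp
    | cons x e => simp only [List.map_cons, evalForm_cons, ih, mul_zpow, mul_comm k a, zpow_mul]

/-- The forms of `S`, evaluated at `e`, are `β, s 0, …, s 5`. -/
def Models (S : List (List ℤ)) (e : List G) (β : G) (s : Fin 6 → G) : Prop :=
  evalForm (S.getD 0 []) e = β ∧ ∀ k : Fin 6, evalForm (S.getD (k + 1) []) e = s k

/-- Elimination only adds multiples of a form of value 1. Soundness needs nothing about the choice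
of the pivot. -/
theorem Models.eliminate {S : List (List ℤ)} {e : List G} {β : G} {s : Fin 6 → G}
    (h : Models S e β s) {r : List ℤ} (hr : evalForm r e = 1) : Models (eliminate r S) e β s := by
  have key : ∀ i, evalForm ((ComplexHadamard.eliminate r S).getD i []) e =
      evalForm (S.getD i []) e := by
    intro i
    have h0 : ∀ f : List ℤ, evalForm (if pivotCoeff r.tail f.tail = 0 then f
        else combineForm (-pivotCoeff r.tail f.tail) f r) e = evalForm f e := by
      intro f
      split_ifs
      · rfl
      · rw [evalForm_combineForm, hr, one_zpow, mul_one]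
    by_cases hi : i < S.length
    · simp [ComplexHadamard.eliminate, List.getD_eq_getElem?_getD, hi, h0]
    · simp [ComplexHadamard.eliminate, List.getD_eq_getElem?_getD, hi]
  exact ⟨(key 0).trans h.1, fun k => (key _).trans (h.2 k)⟩

end Forms

/-- This justifies the branching in `impose`: once a relation is divided by `g`, its value is a
`g`-th root of unity, which some power of `ζ ^ (36 / g)` corrects to 1. -/
theorem Circle.exists_eq_zpow_of_pow_eq_one {ζ : Circle} (hζ : IsPrimitiveRoot (ζ : ℂ) 36)
    {g : ℕ} (hg : g ≠ 0) (hd : 36 % g = 0) {y : Circle} (hy : y ^ g = 1) :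
    ∃ m < g, ζ ^ ((m : ℤ) * (36 / g : ℕ)) * y = 1 := by
  have hd' : 36 / g * g = 36 := Nat.div_mul_cancel (Nat.dvd_of_mod_eq_zero hd)
  have hp : IsPrimitiveRoot ((ζ : ℂ) ^ (36 / g)) g := hζ.pow (by norm_num) hd'.symm
  have : NeZero g := ⟨hg⟩
  obtain ⟨m, hm, hm'⟩ := hp.eq_pow_of_pow_eq_one (ξ := ((y⁻¹ : Circle) : ℂ)) (by
    rw [← Circle.coe_pow, inv_pow, hy, inv_one, Circle.coe_one])
  refine ⟨m, hm, ?_⟩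
  have : y⁻¹ = ζ ^ (36 / g * m) := by
    apply Circle.ext
    rw [← hm', Circle.coe_pow, pow_mul]
  have h2 : ζ ^ ((m : ℤ) * (36 / g : ℕ)) = ζ ^ (36 / g * m) := by
    rw [← zpow_natCast]
    push_cast
    rw [mul_comm]
  rw [h2, ← this, inv_mul_cancel]

theorem Circle.zpow_eq_one_iff {ζ : Circle} (hζ : IsPrimitiveRoot (ζ : ℂ) 36) (c : ℤ) :
    ζ ^ c = 1 ↔ c % 36 = 0 := by
  rw [← Int.dvd_iff_emod_eq_zero]
  have := hζ.zpow_eq_one_iff_dvd c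
  rw [← Circle.coe_zpow, ← Circle.coe_one, Circle.coe_inj] at this
  exact_mod_cast this

/-- The actual solution survives in at least one branch; a contradictory relation between powers of
`ζ` alone yields no branch, but cannot occur for a solution. -/
theorem Models.impose {S : List (List ℤ)} {ζ : Circle} (hζ : IsPrimitiveRoot (ζ : ℂ) 36)
    {e : List Circle} {β : Circle} {s : Fin 6 → Circle}
    (h : Models S (ζ :: e) β s) {r : List ℤ} (hr : evalForm r (ζ :: e) = 1) :
    ∃ S' ∈ impose S r, Models S' (ζ :: e) β s := by
  cases r with
  | nil => exact ⟨S, by simp [ComplexHadamard.impose], h⟩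
  | cons c f =>
    unfold ComplexHadamard.impose
    dsimp only
    split_ifs with h1 h2 h3 h4
    · exact ⟨S, by simp, h⟩
    · exfalso
      rw [evalForm_cons, evalForm_of_forall_eq_zero (by simpa using h1), mul_one,
        Circle.zpow_eq_one_iff hζ] at hr
      exact h2 hr
    · exact ⟨_, by simp, h.eliminate hr⟩
    · obtain ⟨h5, h6, h7⟩ := h4
      rw [← h5, evalForm_map_mul, zpow_natCast] at hr
      obtain ⟨m, hm, hm'⟩ := Circle.exists_eq_zpow_of_pow_eq_one hζ h7 h6 hr
      refine ⟨_, List.mem_map.2 ⟨m, List.mem_range.2 hm, rfl⟩, h.eliminate ?_⟩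
      rw [evalForm_cons] at hm' ⊢
      rw [zpow_add, ← hm']
      rw [mul_left_comm, mul_assoc]
    · exact ⟨S, by simp, h⟩

theorem Models.evalForm_relation {S : List (List ℤ)} {ζ : Circle}
    {e : List Circle} {β : Circle} {s : Fin 6 → Circle}
    (h : Models S (ζ :: e) β s) (a b : Fin 6) (c n : ℤ) :
    evalForm (relation S (a, b, c, n)) (ζ :: e) = s b * (s a)⁻¹ * β ^ n * ζ ^ c := by
  have h1 := h.2 a
  have h2 := h.2 b
  have h3 := h.1
  simp only [relation]
  have h4 : ∀ d, evalForm (if c = 0 then d else combineForm 1 d [c]) (ζ :: e) =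
      evalForm d (ζ :: e) * ζ ^ c := by
    intro d
    split_ifs with hc
    · simp [hc]
    · rw [evalForm_combineForm]
      cases e <;> simp
  have h5 : ∀ d, evalForm (if n = 0 then d else combineForm n d (S.getD 0 [])) (ζ :: e) =
      evalForm d (ζ :: e) * β ^ n := by
    intro d
    split_ifs with hc
    · simp [hc]
    · rw [evalForm_combineForm, h3]
  rw [h4, h5, evalForm_combineForm, h1, h2, zpow_neg_one]

theorem Models.imposeAll {S : List (List ℤ)} {ζ : Circle} (hζ : IsPrimitiveRoot (ζ : ℂ) 36)
    {e : List Circle} {β : Circle} {s : Fin 6 → Circle}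
    (h : Models S (ζ :: e) β s) {l : List (Fin 6 × Fin 6 × ℤ × ℤ)}
    (hl : ∀ r ∈ l, s r.2.1 * (s r.1)⁻¹ * β ^ r.2.2.2 * ζ ^ r.2.2.1 = 1) :
    ∃ S' ∈ imposeAll l S, Models S' (ζ :: e) β s := by
  induction l generalizing S with
  | nil => exact ⟨S, by simp [ComplexHadamard.imposeAll], h⟩
  | cons r l ih =>
    obtain ⟨S₁, hS₁, h₁⟩ := h.impose hζ (r := relation S r) (by
      rw [h.evalForm_relation r.1 r.2.1 r.2.2.1 r.2.2.2]
      exact hl r List.mem_cons_self)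
    obtain ⟨S₂, hS₂, h₂⟩ := ih h₁ fun r hr => hl r (List.mem_cons_of_mem _ hr)
    exact ⟨S₂, List.mem_flatMap.2 ⟨S₁, hS₁, hS₂⟩, h₂⟩

theorem Models.of_holdAll {S : List (List ℤ)} {ζ : Circle} (hζ : IsPrimitiveRoot (ζ : ℂ) 36)
    {e : List Circle} {β : Circle} {s : Fin 6 → Circle}
    (h : Models S (ζ :: e) β s) {l : List (Fin 6 × Fin 6 × ℤ × ℤ)} (hl : holdAll S l = true) :
    ∀ r ∈ l, s r.1 = s r.2.1 * β ^ r.2.2.2 * ζ ^ r.2.2.1 := by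
  intro r hr
  have h1 := h.evalForm_relation r.1 r.2.1 r.2.2.1 r.2.2.2
  have h2 : evalForm (relation S r) (ζ :: e) = 1 := by
    have h3 := List.all_eq_true.1 hl r hr
    generalize relation S r = f at h3
    cases f with
    | nil => simp
    | cons c f =>
      simp only [isTrivialForm, Bool.and_eq_true, List.all_eq_true, decide_eq_true_eq] at h3
      rw [evalForm_cons, evalForm_of_forall_eq_zero h3.1, mul_one, Circle.zpow_eq_one_iff hζ]
      exact h3.2
  rw [h2] at h1
  calc s r.1 = s r.1 * (s r.2.1 * (s r.1)⁻¹ * β ^ r.2.2.2 * ζ ^ r.2.2.1) := by rw [← h1, mul_one]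
    _ = _ := by
      rw [← mul_assoc, ← mul_assoc, ← mul_assoc, mul_comm (s r.1), mul_inv_cancel_right]

/-! ### Patterns of scalar products -/

/-- The function `t` has the pattern `o`, with respect to the root of unity `ζ` of order `36`. -/
def Pattern.Matches (o : Pattern) (ζ : Circle) (t : Fin 6 → Circle) : Prop :=
  ∀ x ∈ (List.finRange 6).zip o.entry, t x.1 = ζ ^ x.2.2 * t x.2.1

theorem length_entry_of_mem_patterns {o : Pattern} (ho : o ∈ patterns) : o.entry.length = 6 := by
  have : (patterns.all fun o => o.entry.length = 6) = true := by decide +kernel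
  simpa using List.all_eq_true.1 this o ho

theorem fst_mem_entry_of_mem_patterns {o : Pattern} (ho : o ∈ patterns) {x : Fin 6 × ℤ}
    (hx : x ∈ o.entry) : x.1 = 0 ∨ x.1 = o.p ∨ x.1 = o.q := by
  have : (patterns.all fun o => o.entry.all fun x => x.1 = 0 ∨ x.1 = o.p ∨ x.1 = o.q) = true := by
    decide +kernel
  simpa using List.all_eq_true.1 (List.all_eq_true.1 this o ho) x hx

/-- The normalisation `s 0 = 1` turns the class of position 0 into pure powers of `ζ`, so at most
`β, s p, s q` remain as unknowns. -/
theorem Pattern.Matches.models {o : Pattern} (ho : o ∈ patterns) {ζ : Circle}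
    {s : Fin 6 → Circle} (h : o.Matches ζ s) (hs : s 0 = 1) (β : Circle) :
    Models o.forms [ζ, β, s o.p, s o.q] β s := by
  refine ⟨by simp [Pattern.forms], fun k => ?_⟩
  have hk : (k : ℕ) < o.entry.length := by
    rw [length_entry_of_mem_patterns ho]
    exact k.2
  have h1 := h (k, o.entry[(k : ℕ)]) (by
    rw [List.mem_iff_getElem]
    refine ⟨k, by simpa using hk, by simp⟩)
  have h2 := fst_mem_entry_of_mem_patterns ho (List.getElem_mem hk)
  simp only at h1
  simp only [Pattern.forms, List.getD_eq_getElem?_getD, List.getElem?_cons_succ, List.getElem?_map,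
    List.getElem?_eq_getElem hk, Option.map_some, Option.getD_some]
  rw [h1]
  split_ifs with h3 h4
  · simp [h3, hs]
  · simp [h4]
  · have h5 : (o.entry[(k : ℕ)]).1 = o.q := by tauto
    simp [h5]

/-- The vector `(1, ω, ω², β, βω, βω²)` with `ω = ζ ^ 12`. -/
noncomputable def fourierRow (ζ β : Circle) (k : Fin 6) : Circle :=
  ζ ^ (12 * ((k : ℕ) % 3 : ℕ) : ℤ) * β ^ (if (k : ℕ) < 3 then 0 else 1 : ℤ)

theorem Pattern.Matches.relations {o : Pattern} {ζ β : Circle} {s : Fin 6 → Circle}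
    (h : o.Matches ζ fun k => s k * (fourierRow ζ β k)⁻¹) :
    ∀ r ∈ o.relations, s r.2.1 * (s r.1)⁻¹ * β ^ r.2.2.2 * ζ ^ r.2.2.1 = 1 := by
  intro r hr
  simp only [Pattern.relations, List.mem_filterMap] at hr
  obtain ⟨x, hx, hx'⟩ := hr
  by_cases h1 : x.1 = x.2.1
  · simp [h1] at hx'
  rw [if_neg h1] at hx'
  obtain rfl := Option.some.inj hx'
  have h2 := h x hx
  simp only [fourierRow] at h2 ⊢
  rw [mul_inv_eq_iff_eq_mul] at h2
  rw [h2, zpow_sub, zpow_sub, zpow_add]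
  apply Circle.ext
  simp only [Circle.coe_mul, Circle.coe_inv, Circle.coe_one]
  field_simp [Circle.coe_ne_zero]

set_option synthInstance.maxSize 4000 in
set_option synthInstance.maxHeartbeats 400000 in
-- The values of a fixed-point-free involution are quantified one at a time, each constraint being
-- stated as soon as it makes sense, so that the exhaustive decision prunes early.
theorem exists_binaryPattern : ∀ a : Fin 6, a ≠ 0 → ∀ b : Fin 6, b ≠ 1 → a ≠ b → (a = 1 ↔ b = 0) →
    ∀ c : Fin 6, c ≠ 2 → a ≠ c → b ≠ c → (a = 2 ↔ c = 0) → (b = 2 ↔ c = 1) →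
    ∀ d : Fin 6, d ≠ 3 → a ≠ d → b ≠ d → c ≠ d → (a = 3 ↔ d = 0) → (b = 3 ↔ d = 1) →
      (c = 3 ↔ d = 2) →
    ∀ e : Fin 6, e ≠ 4 → a ≠ e → b ≠ e → c ≠ e → d ≠ e → (a = 4 ↔ e = 0) → (b = 4 ↔ e = 1) →
      (c = 4 ↔ e = 2) → (d = 4 ↔ e = 3) →
    ∀ g : Fin 6, a ≠ g → b ≠ g → c ≠ g → d ≠ g → e ≠ g →
    ∃ m ∈ matchings, ∀ x ∈ (List.finRange 6).zip (binaryPattern m).entry,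
      (x.2.2 = 0 ∧ x.1 = x.2.1) ∨ (x.2.2 = 18 ∧ ![a, b, c, d, e, g] x.2.1 = x.1) := by
  decide +kernel

set_option synthInstance.maxSize 4000 in
set_option synthInstance.maxHeartbeats 400000 in
-- The same pruning for a permutation all of whose cycles have length three. The separate condition
-- at `0` follows from the next one and discards most candidates first.
theorem exists_ternaryPattern : ∀ a : Fin 6, a ≠ 0 → ∀ b : Fin 6, b ≠ 1 → a ≠ b →
      ¬ (a = 1 ∧ b = 0) →
    ∀ c : Fin 6, c ≠ 2 → a ≠ c → b ≠ c → ¬ (a = 2 ∧ c = 0) → ¬ (b = 2 ∧ c = 1) →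
    ∀ d : Fin 6, d ≠ 3 → a ≠ d → b ≠ d → c ≠ d → ¬ (a = 3 ∧ d = 0) → ¬ (b = 3 ∧ d = 1) →
      ¬ (c = 3 ∧ d = 2) →
    ∀ e : Fin 6, e ≠ 4 → a ≠ e → b ≠ e → c ≠ e → d ≠ e → ¬ (a = 4 ∧ e = 0) → ¬ (b = 4 ∧ e = 1) →
      ¬ (c = 4 ∧ e = 2) → ¬ (d = 4 ∧ e = 3) →
    ∀ g : Fin 6, a ≠ g → b ≠ g → c ≠ g → d ≠ g → e ≠ g → g ≠ 5 →
    ![a, b, c, d, e, g] (![a, b, c, d, e, g] a) = 0 →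
    (∀ k, ![a, b, c, d, e, g] (![a, b, c, d, e, g] (![a, b, c, d, e, g] k)) = k) →
    ∃ m ∈ splittings, ∃ n ∈ [((12 : ℤ), (12 : ℤ)), (12, 24), (24, 12), (24, 24)],
      ∀ x ∈ (List.finRange 6).zip (ternaryPattern m n).entry,
        (x.2.2 = 0 ∧ x.1 = x.2.1) ∨ (x.2.2 = 12 ∧ ![a, b, c, d, e, g] x.2.1 = x.1) ∨
          (x.2.2 = 24 ∧ ![a, b, c, d, e, g] x.1 = x.2.1) := by
  decide +kernel

theorem exists_binaryPattern_of_involutive (f : Fin 6 → Fin 6) (hf : ∀ k, f k ≠ k)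
    (hf' : ∀ k, f (f k) = k) :
    ∃ m ∈ matchings, ∀ x ∈ (List.finRange 6).zip (binaryPattern m).entry,
      (x.2.2 = 0 ∧ x.1 = x.2.1) ∨ (x.2.2 = 18 ∧ f x.2.1 = x.1) := by
  have hinj : ∀ i j, i ≠ j → f i ≠ f j := fun i j hij h => hij (by rw [← hf' i, h, hf'])
  have hsymm : ∀ i j, f i = j ↔ f j = i := fun i j => ⟨fun h => h ▸ hf' i, fun h => h ▸ hf' j⟩
  have h := exists_binaryPattern (f 0) (hf 0) (f 1) (hf 1) (hinj _ _ (by decide)) (hsymm _ _)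
    (f 2) (hf 2) (hinj _ _ (by decide)) (hinj _ _ (by decide)) (hsymm _ _) (hsymm _ _)
    (f 3) (hf 3) (hinj _ _ (by decide)) (hinj _ _ (by decide)) (hinj _ _ (by decide))
    (hsymm _ _) (hsymm _ _) (hsymm _ _)
    (f 4) (hf 4) (hinj _ _ (by decide)) (hinj _ _ (by decide)) (hinj _ _ (by decide))
    (hinj _ _ (by decide)) (hsymm _ _) (hsymm _ _) (hsymm _ _) (hsymm _ _)
    (f 5) (hinj _ _ (by decide)) (hinj _ _ (by decide)) (hinj _ _ (by decide))
    (hinj _ _ (by decide)) (hinj _ _ (by decide))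
  have hv : ![f 0, f 1, f 2, f 3, f 4, f 5] = f := by
    ext k
    fin_cases k <;> rfl
  rwa [hv] at h

theorem exists_ternaryPattern_of_iterate (f : Fin 6 → Fin 6) (hf : ∀ k, f k ≠ k)
    (hf' : ∀ k, f (f (f k)) = k) :
    ∃ m ∈ splittings, ∃ n ∈ [((12 : ℤ), (12 : ℤ)), (12, 24), (24, 12), (24, 24)],
      ∀ x ∈ (List.finRange 6).zip (ternaryPattern m n).entry,
        (x.2.2 = 0 ∧ x.1 = x.2.1) ∨ (x.2.2 = 12 ∧ f x.2.1 = x.1) ∨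
          (x.2.2 = 24 ∧ f x.1 = x.2.1) := by
  have hinj : ∀ i j, i ≠ j → f i ≠ f j := fun i j hij h => hij (by rw [← hf' i, h, hf'])
  have hsymm : ∀ i j, ¬ (f i = j ∧ f j = i) := fun i j h => hf i (by
    have := hf' i
    rw [h.1, h.2] at this
    exact this)
  have hv : ![f 0, f 1, f 2, f 3, f 4, f 5] = f := by
    ext k
    fin_cases k <;> rfl
  have h := exists_ternaryPattern (f 0) (hf 0) (f 1) (hf 1) (hinj _ _ (by decide)) (hsymm _ _)
    (f 2) (hf 2) (hinj _ _ (by decide)) (hinj _ _ (by decide)) (hsymm _ _) (hsymm _ _)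
    (f 3) (hf 3) (hinj _ _ (by decide)) (hinj _ _ (by decide)) (hinj _ _ (by decide))
    (hsymm _ _) (hsymm _ _) (hsymm _ _)
    (f 4) (hf 4) (hinj _ _ (by decide)) (hinj _ _ (by decide)) (hinj _ _ (by decide))
    (hinj _ _ (by decide)) (hsymm _ _) (hsymm _ _) (hsymm _ _) (hsymm _ _)
    (f 5) (hinj _ _ (by decide)) (hinj _ _ (by decide)) (hinj _ _ (by decide))
    (hinj _ _ (by decide)) (hinj _ _ (by decide)) (hf 5)
    (by rw [hv, hf']) (by rw [hv]; exact hf')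
  rwa [hv] at h
-- The computational heart: 15 binary and 40 ternary patterns, hence 55² systems, all solved by
-- kernel evaluation.
theorem all_checkPattern : patterns.all checkPattern = true := by decide +kernel

/-! ### From scalar products to the dichotomy for a third row -/

/-- The primitive root of unity `e^{2πi/36}`. -/
noncomputable def zeta : Circle := Circle.exp (2 * Real.pi / 36)

theorem coe_zeta : (zeta : ℂ) = Complex.exp (2 * Real.pi * Complex.I / (36 : ℕ)) := by
  rw [zeta, Circle.coe_exp]
  congr 1
  push_cast
  ring

theorem isPrimitiveRoot_zeta : IsPrimitiveRoot (zeta : ℂ) 36 := by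
  rw [coe_zeta]
  exact Complex.isPrimitiveRoot_exp 36 (by norm_num)

/-- The cube root of unity `e^{2πi/3}`, as an element of the circle. -/
noncomputable def omega : Circle := zeta ^ 12

theorem coe_omega : (omega : ℂ) = cubeRoot := by
  rw [omega, Circle.coe_pow, coe_zeta, ← Complex.exp_nat_mul, cubeRoot]
  congr 1
  push_cast
  ring

theorem coe_zeta_pow_eighteen : (zeta : ℂ) ^ 18 = -1 := by
  rw [coe_zeta, ← Complex.exp_nat_mul, ← Complex.exp_pi_mul_I]
  congr 1
  push_cast
  ring

theorem isPrimitiveRoot_cubeRoot : IsPrimitiveRoot cubeRoot 3 := by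
  rw [← coe_omega, omega, Circle.coe_pow]
  exact isPrimitiveRoot_zeta.pow (by norm_num) (by norm_num)

theorem cubeRoot_pow_three : cubeRoot ^ 3 = 1 := isPrimitiveRoot_cubeRoot.pow_eq_one

theorem omega_pow_three : omega ^ 3 = 1 := by
  apply Circle.ext
  rw [Circle.coe_pow, coe_omega, cubeRoot_pow_three, Circle.coe_one]

theorem zeta_pow_twelve : zeta ^ 12 = omega := rfl

theorem zeta_pow_twentyfour : zeta ^ 24 = omega ^ 2 := by
  rw [omega, ← pow_mul]

theorem zeta_zpow_twelve : zeta ^ (12 : ℤ) = omega := by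
  rw [omega]
  norm_cast

theorem zeta_zpow_twentyfour : zeta ^ (24 : ℤ) = omega ^ 2 := by
  rw [omega, ← pow_mul]
  norm_cast

theorem coe_zeta_zpow_eighteen : ((zeta ^ (18 : ℤ) : Circle) : ℂ) = -1 := by
  rw [← coe_zeta_pow_eighteen]
  norm_cast

/-- The pairing of opposite terms is a fixed-point-free involution of the positions, and this
involution determines the pattern. -/
theorem IsBinary.exists_pattern {u v : Fin 6 → ℂ} (h : IsBinary u v) {t : Fin 6 → Circle}
    (ht : ∀ k, (t k : ℂ) = u k * star (v k)) : ∃ o ∈ patterns, o.Matches zeta t := by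
  obtain ⟨σ, x, y, z, hσ⟩ := h
  have h0 : ∀ k, (t (σ k) : ℂ) = ![(x : ℂ), -x, y, -y, z, -z] k := fun k => by
    rw [ht, ← hσ]
  have h1 : ∀ k, (t (σ (![1, 0, 3, 2, 5, 4] k)) : ℂ) = - t (σ k) := by
    intro k
    rw [h0, h0]
    fin_cases k <;> simp
  obtain ⟨m, hm, hm'⟩ := exists_binaryPattern_of_involutive
    (fun k => σ (![1, 0, 3, 2, 5, 4] (σ.symm k)))
    (fun k h => by
      rw [← Equiv.eq_symm_apply] at h
      revert h
      generalize σ.symm k = i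
      revert i
      decide)
    (fun k => by
      rw [Equiv.symm_apply_apply, ← Equiv.eq_symm_apply]
      generalize σ.symm k = i
      revert i
      decide)
  refine ⟨binaryPattern m, List.mem_append_left _ (List.mem_map_of_mem hm), fun r hr => ?_⟩
  apply Circle.ext
  rcases hm' r hr with ⟨h2, h3⟩ | ⟨h2, h3⟩
  · simp [h2, h3]
  · rw [h2, Circle.coe_mul, coe_zeta_zpow_eighteen, ← h3, h1]
    simp

/-- Multiplication of the terms by `ω` is realised by a permutation of the positions with two
3-cycles, which determines splitting and orientations. -/
theorem IsTernary.exists_pattern {u v : Fin 6 → ℂ} (h : IsTernary u v) {t : Fin 6 → Circle}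
    (ht : ∀ k, (t k : ℂ) = u k * star (v k)) : ∃ o ∈ patterns, o.Matches zeta t := by
  obtain ⟨σ, x, y, hσ⟩ := h
  have h0 : ∀ k, (t (σ k) : ℂ) = ![(x : ℂ), cubeRoot * x, cubeRoot ^ 2 * x, y, cubeRoot * y,
      cubeRoot ^ 2 * y] k := fun k => by
    rw [ht, ← hσ]
  have h1 : ∀ k, t (σ (![1, 2, 0, 4, 5, 3] k)) = omega * t (σ k) := by
    intro k
    apply Circle.ext
    rw [Circle.coe_mul, coe_omega, h0, h0]
    have h3 := cubeRoot_pow_three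
    fin_cases k <;> simp <;> grind
  obtain ⟨m, hm, n, hn, hm'⟩ := exists_ternaryPattern_of_iterate
    (fun k => σ (![1, 2, 0, 4, 5, 3] (σ.symm k)))
    (fun k h => by
      rw [← Equiv.eq_symm_apply] at h
      revert h
      generalize σ.symm k = i
      revert i
      decide)
    (fun k => by
      rw [Equiv.symm_apply_apply, Equiv.symm_apply_apply, ← Equiv.eq_symm_apply]
      generalize σ.symm k = i
      revert i
      decide)
  refine ⟨ternaryPattern m n, by
    simp only [patterns, List.mem_append, List.mem_flatMap]
    exact Or.inr ⟨m, hm, List.mem_map_of_mem hn⟩, fun r hr => ?_⟩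
  rcases hm' r hr with ⟨h2, h3⟩ | ⟨h2, h3⟩ | ⟨h2, h3⟩
  · simp [h2, h3]
  · rw [h2, zeta_zpow_twelve, ← h3, h1]
    simp
  · rw [h2, zeta_zpow_twentyfour, ← h3, h1, Equiv.apply_symm_apply, ← mul_assoc, ← pow_succ,
      omega_pow_three, one_mul]

theorem fourierRow_eq (β : Circle) : fourierRow zeta β =
    ![1, omega, omega ^ 2, β, omega * β, omega ^ 2 * β] := by
  ext k
  fin_cases k <;> simp [fourierRow, -Circle.coe_pow, zeta_pow_twelve, zeta_pow_twentyfour]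

theorem Models.of_fourierRelations {S : List (List ℤ)} {e : List Circle} {β : Circle}
    {s : Fin 6 → Circle} (h : Models S (zeta :: e) β s) {a b : Fin 6} {n : ℤ}
    (h1 : holdAll S (fourierRelations a b n) = true) :
    fourierRow zeta β b = zeta ^ (12 * n) * fourierRow zeta β a ∧
      s b = zeta ^ (24 * n) * s a := by
  have h2 := h.of_holdAll isPrimitiveRoot_zeta h1
  simp only [fourierRelations, List.forall_mem_cons] at h2
  obtain ⟨h2, h3, -⟩ := h2
  constructor
  · rw [mul_assoc, eq_comm, mul_eq_left] at h2
    simp only [fourierRow]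
    rw [zpow_sub, zpow_sub, zpow_add] at h2
    have h4 := congrArg (fun z : Circle => (z : ℂ)) h2
    apply Circle.ext
    simp only [Circle.coe_mul, Circle.coe_inv, Circle.coe_one] at h4 ⊢
    field_simp [Circle.coe_ne_zero] at h4
    linear_combination -h4
  · rw [h3, zpow_zero, mul_one, mul_comm]

/-- Here `s` is the quotient of the first row by a third one, and `fourierRow` is, up to a scalar,
its quotient by the second. The first two exceptional cases say that `s`, or its quotient by
`fourierRow`, is constant on the first triple and opposite at position 3. In the other three,
columns 3 and `m` agree in `fourierRow` and are opposite in `s`, for `m = 0, 1, 2`. -/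
theorem fourier_or_exceptional (β : Circle) (s : Fin 6 → Circle)
    (h1 : ∃ o ∈ patterns, o.Matches zeta s)
    (h2 : ∃ o ∈ patterns, o.Matches zeta fun k => s k * (fourierRow zeta β k)⁻¹) :
    (∃ a b c, fourierRow zeta β b = omega * fourierRow zeta β a ∧
      fourierRow zeta β c = omega ^ 2 * fourierRow zeta β a ∧
      s b = omega ^ 2 * s a ∧ s c = omega * s a) ∨
    (s 1 = s 0 ∧ s 2 = s 0 ∧ (s 3 : ℂ) = - s 0) ∨
    (s 1 = omega * s 0 ∧ s 2 = omega ^ 2 * s 0 ∧ (s 3 : ℂ) = - (β * s 0)) ∨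
    (β = 1 ∧ (s 3 : ℂ) = - s 0) ∨ (β = omega ∧ (s 3 : ℂ) = - s 1) ∨
    (β = omega ^ 2 ∧ (s 3 : ℂ) = - s 2) := by
  wlog hs : s 0 = 1 generalizing s
  · have h := this (fun k => s k * (s 0)⁻¹) ?_ ?_ (mul_inv_cancel _)
    · simp only [← mul_assoc, mul_left_inj, Circle.coe_mul, ← neg_mul, Circle.coe_inv,
        mul_eq_mul_right_iff, inv_eq_zero, Circle.coe_ne_zero, or_false] at h
      simpa only [neg_mul] using h
    · obtain ⟨o, ho, h⟩ := h1
      exact ⟨o, ho, fun x hx => by simp only [h x hx, mul_assoc]⟩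
    · obtain ⟨o, ho, h⟩ := h2
      refine ⟨o, ho, fun x hx => ?_⟩
      have := h x hx
      simp only at this ⊢
      rw [mul_right_comm, this, mul_right_comm (s x.2.1), mul_assoc]
  obtain ⟨o, ho, h1⟩ := h1
  obtain ⟨o', ho', h2⟩ := h2
  obtain ⟨S, hS, hm⟩ := (h1.models ho hs β).imposeAll isPrimitiveRoot_zeta h2.relations
  have h3 := List.all_eq_true.1 (List.all_eq_true.1 (List.all_eq_true.1 all_checkPattern o ho)
    o' ho') S hS
  rw [Bool.or_eq_true] at h3
  have neg : ∀ x y : Circle, x = y * zeta ^ (18 : ℤ) → (x : ℂ) = - y := fun x y h => by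
    rw [h, Circle.coe_mul, coe_zeta_zpow_eighteen, mul_neg_one]
  rcases h3 with h3 | h3
  · right
    simp only [isExceptional, Bool.or_eq_true] at h3
    rcases h3 with (((h3 | h3) | h3) | h3) | h3 <;>
    have h4 := hm.of_holdAll isPrimitiveRoot_zeta h3 <;>
    simp only [List.forall_mem_cons, zpow_zero, mul_one, zpow_one, List.not_mem_nil,
      IsEmpty.forall_iff, implies_true, and_true, zeta_zpow_twelve, zeta_zpow_twentyfour,
      hs, one_mul] at h4
    · exact Or.inl ⟨by rw [h4.1, hs], by rw [h4.2.1, hs], neg _ _ (by rw [h4.2.2, hs, one_mul])⟩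
    · refine Or.inr (Or.inl ⟨by rw [h4.1, hs, mul_one], by rw [h4.2.1, hs, mul_one], ?_⟩)
      rw [← Circle.coe_mul]
      exact neg _ _ (by rw [h4.2.2, hs, mul_one])
    · exact Or.inr (Or.inr (Or.inl ⟨h4.1.symm, neg _ _ (by rw [h4.2, hs, one_mul])⟩))
    · refine Or.inr (Or.inr (Or.inr (Or.inl ⟨?_, neg _ _ h4.2⟩)))
      rw [← mul_one β, ← omega_pow_three, pow_succ, ← mul_assoc, ← h4.1, one_mul]
    · refine Or.inr (Or.inr (Or.inr (Or.inr ⟨?_, neg _ _ h4.2⟩)))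
      rw [← mul_one β, ← omega_pow_three, pow_succ', ← mul_assoc, ← h4.1, one_mul]
  · left
    simp only [hasFourier, List.any_eq_true, Bool.and_eq_true, decide_eq_true_eq] at h3
    obtain ⟨a, -, b, -, ⟨-, h4⟩, c, -, -, h5⟩ := h3
    refine ⟨a, b, c, ?_⟩
    have h6 := hm.of_fourierRelations h4
    have h7 := hm.of_fourierRelations h5
    have h8 : zeta ^ (48 : ℤ) = omega := by
      rw [show (48 : ℤ) = 36 + 12 by norm_num, zpow_add, zeta_zpow_twelve,
        (Circle.zpow_eq_one_iff isPrimitiveRoot_zeta 36).2 (by norm_num), one_mul]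
    norm_num [zeta_pow_twelve, zeta_pow_twentyfour, h8] at h6 h7
    exact ⟨h6.1, h7.1, h6.2, h7.2⟩

/-! ### Existence of a Fourier submatrix -/

theorem IsBinary.comp {u v : Fin 6 → ℂ} (h : IsBinary u v) (σ : Equiv.Perm (Fin 6)) :
    IsBinary (fun k => u (σ k)) (fun k => v (σ k)) := by
  obtain ⟨τ, x, y, z, h⟩ := h
  exact ⟨τ.trans σ.symm, x, y, z, by simpa using h⟩

theorem IsTernary.comp {u v : Fin 6 → ℂ} (h : IsTernary u v) (σ : Equiv.Perm (Fin 6)) :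
    IsTernary (fun k => u (σ k)) (fun k => v (σ k)) := by
  obtain ⟨τ, x, y, h⟩ := h
  exact ⟨τ.trans σ.symm, x, y, by simpa using h⟩

/-- A one-sided inverse of a square matrix is two-sided, so `h h* = n` gives `h* h = n`. -/
theorem IsHadamard.sum_columns {n : Type*} [Fintype n] [DecidableEq n] {h : Matrix n n ℂ}
    (hh : IsHadamard h) {k l : n} (hkl : k ≠ l) : ∑ i, star (h i k) * h i l = 0 := by
  have h1 : h * h.conjTranspose = (Fintype.card n : ℂ) • (1 : Matrix n n ℂ) := by
    ext i j
    rw [Matrix.mul_apply]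
    by_cases hij : i = j
    · subst hij
      have : ∀ k, h i k * h.conjTranspose k i = 1 := fun k => by
        rw [Matrix.conjTranspose_apply, Complex.star_def, Complex.mul_conj, Complex.normSq_eq_norm_sq,
          hh.1]
        simp
      rw [Finset.sum_congr rfl fun k _ => this k]
      simp
    · simpa [hij] using hh.2 i j hij
  have hn : (Fintype.card n : ℂ) ≠ 0 := by
    have : Nonempty n := ⟨k⟩
    exact_mod_cast Fintype.card_ne_zero
  have h2 : ((Fintype.card n : ℂ)⁻¹ • h.conjTranspose) * h = 1 := by
    rw [mul_eq_one_comm, Matrix.mul_smul, h1, smul_smul, inv_mul_cancel₀ hn, one_smul]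
  have h3 := congrFun (congrFun h2 k) l
  rw [Matrix.smul_mul, Matrix.smul_apply, Matrix.one_apply_ne hkl, smul_eq_zero] at h3
  rcases h3 with h3 | h3
  · exact absurd h3 (inv_ne_zero hn)
  · simpa [Matrix.mul_apply] using h3

theorem cubeRoot_eq : cubeRoot = -1 / 2 + (Real.sqrt 3 / 2 : ℝ) * Complex.I := by
  rw [cubeRoot, show (2 * Real.pi * Complex.I / 3 : ℂ) = ((2 * Real.pi / 3 : ℝ) : ℂ) * Complex.I by
    push_cast; ring, Complex.exp_mul_I, ← Complex.ofReal_cos, ← Complex.ofReal_sin,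
    show 2 * Real.pi / 3 = Real.pi - Real.pi / 3 by ring, Real.cos_pi_sub, Real.sin_pi_sub,
    Real.cos_pi_div_three, Real.sin_pi_div_three]
  push_cast
  ring

theorem cubeRoot_im_pos : 0 < cubeRoot.im := by
  rw [cubeRoot_eq]
  simp

/-- A matrix all of whose scalar products of rows are binary or ternary, one of them being
ternary, contains a Fourier matrix of order three. -/
theorem exists_fourier_submatrix {h : Matrix (Fin 6) (Fin 6) ℂ} (hh : IsHadamard h)
    (hbt : ∀ i j, i ≠ j → IsBinary (h i) (h j) ∨ IsTernary (h i) (h j)) {i₀ i₁ : Fin 6}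
    (hi : i₀ ≠ i₁) (ht : IsTernary (h i₀) (h i₁)) :
    ∃ i₂ c₀ c₁ c₂, i₂ ≠ i₀ ∧ i₂ ≠ i₁ ∧
      h i₀ c₁ * star (h i₁ c₁) = cubeRoot * (h i₀ c₀ * star (h i₁ c₀)) ∧
      h i₀ c₂ * star (h i₁ c₂) = cubeRoot ^ 2 * (h i₀ c₀ * star (h i₁ c₀)) ∧
      h i₀ c₁ * star (h i₂ c₁) = cubeRoot ^ 2 * (h i₀ c₀ * star (h i₂ c₀)) ∧
      h i₀ c₂ * star (h i₂ c₂) = cubeRoot * (h i₀ c₀ * star (h i₂ c₀)) := by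
  obtain ⟨σ, x, y, hσ⟩ := ht
  have hH : ∀ i k, ∃ z : Circle, (z : ℂ) = h i (σ k) := fun i k =>
    ⟨⟨h i (σ k), by simp [Submonoid.unitSphere, hh.1]⟩, rfl⟩
  choose H hH using hH
  set s : Fin 6 → Fin 6 → Circle := fun i k => H i₀ k * (H i k)⁻¹ with hs
  have hs' : ∀ i k, (s i k : ℂ) = h i₀ (σ k) * star (h i (σ k)) := fun i k => by
    rw [hs, ← hH, ← hH, Circle.coe_mul, Circle.coe_inv_eq_conj]
    rfl
  have hst : ∀ k, s i₁ k = x * fourierRow zeta (y * x⁻¹) k := fun k => by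
    apply Circle.ext
    rw [hs', fourierRow_eq]
    rw [show h i₀ (σ k) * star (h i₁ (σ k)) = _ from congrFun hσ k]
    fin_cases k <;> simp [coe_omega] <;> field_simp [Circle.coe_ne_zero]
  have hpat : ∀ i j, i ≠ j → ∃ o ∈ patterns, o.Matches zeta fun k => H i k * (H j k)⁻¹ := by
    intro i j hij
    have h1 : ∀ k, ((H i k * (H j k)⁻¹ : Circle) : ℂ) = h i (σ k) * star (h j (σ k)) := fun k => by
      rw [← hH, ← hH, Circle.coe_mul, Circle.coe_inv_eq_conj]
      rfl
    rcases hbt i j hij with h2 | h2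
    · exact (h2.comp σ).exists_pattern h1
    · exact (h2.comp σ).exists_pattern h1
  have key := fun i (h0 : i ≠ i₀) (h1 : i ≠ i₁) =>
    fourier_or_exceptional (y * x⁻¹) (s i) (hpat i₀ i h0.symm) (by
      obtain ⟨o, ho, h2⟩ := hpat i₁ i h1.symm
      refine ⟨o, ho, fun z hz => ?_⟩
      have h3 : ∀ k, s i k * (fourierRow zeta (y * x⁻¹) k)⁻¹ = x * (H i₁ k * (H i k)⁻¹) := by
        intro k
        rw [mul_inv_eq_iff_eq_mul, mul_right_comm, ← hst]
        simp [hs]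
      simp only [h3]
      rw [show H i₁ z.1 * (H i z.1)⁻¹ = _ from h2 z hz, mul_left_comm])
  by_contra hcon
  have key' : ∀ i, i ≠ i₀ → i ≠ i₁ → _ := fun i h0 h1 => (key i h0 h1).resolve_left (by
    rintro ⟨a, b, c, h2, h3, h4, h5⟩
    refine hcon ⟨i, σ a, σ b, σ c, h0, h1, ?_⟩
    simp only [← hs', ← coe_omega, ← Circle.coe_pow, ← Circle.coe_mul, Circle.coe_inj]
    rw [hst, hst, hst, h2, h3, h4, h5]
    simp only [mul_left_comm, and_self])
  have hcol : ∀ k l, k ≠ l → ∑ i, (s i l : ℂ) * star (s i k : ℂ) = 0 := by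
    intro k l hkl
    have h1 := hh.sum_columns (σ.injective.ne hkl.symm)
    have h2 : ∀ i, (s i l : ℂ) * star (s i k : ℂ) = (h i₀ (σ l) * star (h i₀ (σ k))) *
        (star (h i (σ l)) * h i (σ k)) := fun i => by
      rw [hs', hs', star_mul', star_star]
      ring
    rw [Finset.sum_congr rfl fun i _ => h2 i, ← Finset.mul_sum, h1, mul_zero]
  have hself : ∀ z : Circle, (z : ℂ) * star (z : ℂ) = 1 := fun z => by
    rw [Complex.star_def, Complex.mul_conj, Circle.normSq_coe, Complex.ofReal_one]
  have h00 : ∀ k, s i₀ k = 1 := fun k => by simp [hs]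
  -- If columns `m` and 3 agree in rows `i₀, i₁` and are opposite in the other four, their scalar
  -- product is 2 - 4 = -2.
  have hfalse : ∀ m : Fin 6, m ≠ 3 → s i₁ 3 = s i₁ m →
      (∀ i, i ≠ i₀ → i ≠ i₁ → (s i 3 : ℂ) = - s i m) → False := by
    intro m hm h1 h2
    have h3 := hcol m 3 hm
    have h4 : ∀ i, (s i 3 : ℂ) * star (s i m : ℂ) =
        (if i = i₀ then 2 else 0) + (if i = i₁ then 2 else 0) - 1 := by
      intro i
      by_cases h5 : i = i₀
      · subst h5
        rw [h00, h00, hself]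
        simp [hi]
        norm_num
      · by_cases h6 : i = i₁
        · subst h6
          rw [h1, hself]
          simp [h5]
          norm_num
        · rw [h2 i h5 h6, neg_mul, hself]
          simp [h5, h6]
    rw [Finset.sum_congr rfl fun i _ => h4 i] at h3
    simp [Finset.sum_add_distrib] at h3
    norm_num at h3
  have hvals := fourierRow_eq (y * x⁻¹)
  -- For `β = ω ^ m`, every exceptional case still possible makes columns `m` and 3 opposite in the
  -- third row, so `hfalse` applies.
  by_cases hβ : ∃ m : Fin 3, y * x⁻¹ = omega ^ (m : ℕ)
  · have n1 : (1 : Circle) ≠ omega := fun h => by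
      have := isPrimitiveRoot_cubeRoot.ne_one (by norm_num)
      rw [← coe_omega, ← h] at this
      exact this Circle.coe_one
    have n2 : (1 : Circle) ≠ omega ^ 2 := fun h => n1 (by
      rw [← omega_pow_three, pow_succ, ← h, one_mul])
    have n3 : omega ≠ omega ^ 2 := fun h => n1 (by
      rw [pow_two, eq_comm, mul_eq_left] at h
      exact h.symm)
    obtain ⟨m, hm⟩ := hβ
    rw [hm] at key' hvals
    fin_cases m
    · refine hfalse 0 (by decide) (by rw [hst, hst, hm, hvals]; simp) fun i h5 h6 => ?_
      rcases key' i h5 h6 with h | h | h | h | h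
      · exact h.2.2
      · simpa using h.2.2
      · exact h.2
      · exact absurd h.1 (by simpa using n1)
      · exact absurd h.1 (by simpa using n2)
    · refine hfalse 1 (by decide) (by rw [hst, hst, hm, hvals]; simp) fun i h5 h6 => ?_
      rcases key' i h5 h6 with h | h | h | h | h
      · rw [h.1, h.2.2]
      · rw [h.1, h.2.2]
        simp
      · exact absurd h.1.symm (by simpa using n1)
      · exact h.2
      · exact absurd h.1 (by simpa using n3)
    · refine hfalse 2 (by decide) (by rw [hst, hst, hm, hvals]; simp) fun i h5 h6 => ?_
      rcases key' i h5 h6 with h | h | h | h | h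
      · rw [h.2.1, h.2.2]
      · rw [h.2.1, h.2.2]
        simp
      · exact absurd h.1.symm (by simpa using n2)
      · exact absurd h.1.symm (by simpa using n3)
      · exact h.2
  -- Otherwise only the first two exceptional cases remain. The terms of the product of columns 0
  -- and 1 are then 1 or `ω`, with `ω` in row `i₁`, so its imaginary part is positive.
  · have h1 : ∀ i, s i 1 = s i 0 ∨ s i 1 = omega * s i 0 := by
      intro i
      by_cases h5 : i = i₀
      · left
        rw [h5, h00, h00]
      · by_cases h6 : i = i₁
        · right
          rw [h6, hst, hst, hvals]
          simp [mul_comm]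
        · rcases key' i h5 h6 with h | h | h | h | h
          · exact Or.inl h.1
          · exact Or.inr h.1
          · exact absurd ⟨0, by simpa using h.1⟩ hβ
          · exact absurd ⟨1, by simpa using h.1⟩ hβ
          · exact absurd ⟨2, by simpa using h.1⟩ hβ
    have h2 := congrArg Complex.im (hcol 0 1 (by decide))
    rw [Complex.im_sum] at h2
    have h3 : ∀ i, s i 1 = omega * s i 0 → ((s i 1 : ℂ) * star (s i 0 : ℂ)).im = cubeRoot.im := by
      intro i h
      rw [h, Circle.coe_mul, mul_assoc, hself, mul_one, coe_omega]
    refine (Finset.sum_pos' (fun i _ => ?_) ⟨i₁, Finset.mem_univ _, ?_⟩).ne' h2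
    · rcases h1 i with h | h
      · rw [h, hself]
        simp
      · rw [h3 i h]
        exact cubeRoot_im_pos.le
    · rw [h3 i₁ (by rw [hst, hst, hvals]; simp [mul_comm])]
      exact cubeRoot_im_pos

/-! ### Algebra of cube roots of unity and circulant systems -/

theorem mul_star_of_norm_one {z : ℂ} (hz : ‖z‖ = 1) : z * star z = 1 := by
  rw [Complex.star_def, Complex.mul_conj, Complex.normSq_eq_norm_sq, hz]
  simp

theorem cubeRoot_sq_add : cubeRoot ^ 2 + cubeRoot + 1 = 0 := by
  have h1 : cubeRoot - 1 ≠ 0 := sub_ne_zero.2 (isPrimitiveRoot_cubeRoot.ne_one (by norm_num))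
  have h2 := cubeRoot_pow_three
  apply mul_left_cancel₀ h1
  linear_combination h2

theorem norm_cubeRoot : ‖cubeRoot‖ = 1 := by
  rw [← coe_omega]
  exact Circle.norm_coe _

theorem star_cubeRoot : star cubeRoot = cubeRoot ^ 2 := by
  have h := mul_star_of_norm_one norm_cubeRoot
  linear_combination cubeRoot ^ 2 * h - star cubeRoot * cubeRoot_pow_three

/-- Conjugating the sum gives `ab + bc + ca = 0`, hence `a² + ab + b² = 0`, which factors over the
cube roots of unity. -/
theorem eq_of_add_eq_zero {w a b c : ℂ} (hw : w ^ 2 + w + 1 = 0) (ha : ‖a‖ = 1) (hb : ‖b‖ = 1)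
    (hc : ‖c‖ = 1) (h : a + b + c = 0) :
    (b = w * a ∧ c = w ^ 2 * a) ∨ (b = w ^ 2 * a ∧ c = w * a) := by
  have ha' := mul_star_of_norm_one ha
  have hb' := mul_star_of_norm_one hb
  have hc' := mul_star_of_norm_one hc
  have h' : star a + star b + star c = 0 := by
    rw [← star_add, ← star_add, h, star_zero]
  have h1 : (b - w * a) * (b - w ^ 2 * a) = 0 := by
    have h2 : b * c + a * c + a * b = 0 := by
      linear_combination (a * b * c) * h' - b * c * ha' - a * c * hb' - a * b * hc'
    linear_combination -h2 + (a + b) * h + (w * a ^ 2 - a ^ 2 - a * b) * hw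
  rcases mul_eq_zero.1 h1 with h2 | h2
  · left
    constructor
    · linear_combination h2
    · linear_combination h - h2 - a * hw
  · right
    constructor
    · linear_combination h2
    · linear_combination h - h2 - a * hw

/-- The relation between the discrete Fourier coefficients of three complex numbers of modulus
one. -/
theorem fourier_autocorrelation {w a b c p q r : ℂ} (hw : w ^ 2 + w + 1 = 0)
    (hw' : star w = w ^ 2) (ha : ‖a‖ = 1) (hb : ‖b‖ = 1) (hc : ‖c‖ = 1)
    (hp : a + b + c = p) (hq : a + w ^ 2 * b + w * c = q) (hr : a + w * b + w ^ 2 * c = r) :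
    p * star q + q * star r + r * star p = 0 := by
  have ha' := mul_star_of_norm_one ha
  have hb' := mul_star_of_norm_one hb
  have hc' := mul_star_of_norm_one hc
  have h3 : w ^ 3 = 1 := by linear_combination (w - 1) * hw
  subst hp hq hr
  simp only [star_add, star_mul', star_pow, hw']
  generalize star a = a', star b = b', star c = c' at *
  grind

/-- The kernel of a circulant matrix of order three with zero sums of rows. -/
theorem circulant_kernel {w t₀ t₁ t₂ d₀ d₁ d₂ : ℂ} (hw : w ^ 2 + w + 1 = 0)
    (ht : t₀ + t₁ + t₂ = 0) (h0 : t₀ * d₀ + t₂ * d₁ + t₁ * d₂ = 0)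
    (h1 : t₁ * d₀ + t₀ * d₁ + t₂ * d₂ = 0) (h2 : t₂ * d₀ + t₁ * d₁ + t₀ * d₂ = 0)
    (hd₀ : ‖d₀‖ = 1) (hd₁ : ‖d₁‖ = 1) (hd₂ : ‖d₂‖ = 1) :
    (t₀ = 0 ∧ t₁ = 0 ∧ t₂ = 0) ∨ (d₁ = d₀ ∧ d₂ = d₀) ∨
    (t₀ ≠ 0 ∧ d₁ = w ^ 2 * d₀ ∧ d₂ = w * d₀ ∧ t₁ = w * t₀ ∧ t₂ = w ^ 2 * t₀) ∨
    (t₀ ≠ 0 ∧ d₁ = w * d₀ ∧ d₂ = w ^ 2 * d₀ ∧ t₁ = w ^ 2 * t₀ ∧ t₂ = w * t₀) := by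
  have h3 : w ^ 3 = 1 := by linear_combination (w - 1) * hw
  have hw0 : w ≠ 0 := fun h => by simp [h] at h3
  have hw1 : w ≠ 1 := fun h => by
    rw [h] at hw
    norm_num at hw
  have hnw : ‖w‖ = 1 := by
    have := congrArg norm h3
    rw [norm_pow, norm_one] at this
    exact (pow_eq_one_iff_of_nonneg (norm_nonneg _) (by norm_num)).1 this
  -- The Fourier transform diagonalises the circulant system. The trivial character gives nothing,
  -- since the transform of `t` vanishes there.
  have e1 : (t₀ + w * t₁ + w ^ 2 * t₂) * (d₀ + w * d₁ + w ^ 2 * d₂) = 0 := by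
    linear_combination h0 + w * h1 + w ^ 2 * h2 + (t₂ * d₁ + t₁ * d₂ + w * t₂ * d₂) * h3
  have e2 : (t₀ + w ^ 2 * t₁ + w * t₂) * (d₀ + w ^ 2 * d₁ + w * d₂) = 0 := by
    linear_combination h0 + w ^ 2 * h1 + w * h2 +
      (t₂ * d₁ + t₁ * d₂ + w * t₁ * d₁) * h3
  by_cases ht0 : t₀ = 0 ∧ t₁ = 0 ∧ t₂ = 0
  · exact Or.inl ht0
  by_cases hd0 : d₁ = d₀ ∧ d₂ = d₀
  · exact Or.inr (Or.inl hd0)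
  refine Or.inr (Or.inr ?_)
  have n1 : 1 - w ≠ 0 := sub_ne_zero.2 hw1.symm
  -- If both vanishing factors belong to `t`, then `t = 0`; if both belong to `d`, then `d` is
  -- constant. In the mixed cases two vanishing transforms make `t` geometric, and one makes the
  -- unimodular `d` geometric or constant.
  rcases mul_eq_zero.1 e1 with e1 | e1 <;> rcases mul_eq_zero.1 e2 with e2 | e2
  · refine absurd ⟨?_, ?_, ?_⟩ ht0 <;> grind
  · left
    have h4 : t₁ = w * t₀ := by
      apply mul_left_cancel₀ n1
      grind
    have h5 : t₂ = w ^ 2 * t₀ := by linear_combination ht - h4 - t₀ * hw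
    have h6 : t₀ ≠ 0 := fun h => ht0 ⟨h, by rw [h4, h, mul_zero], by rw [h5, h, mul_zero]⟩
    rcases eq_of_add_eq_zero hw hd₀ (b := w ^ 2 * d₁) (c := w * d₂) (by simp [hnw, hd₁])
      (by simp [hnw, hd₂]) e2 with ⟨h7, h8⟩ | ⟨h7, h8⟩
    · exact ⟨h6, by linear_combination w * h7 - d₁ * h3, by
        linear_combination w ^ 2 * h8 + (w * d₀ - d₂) * h3, h4, h5⟩
    · exact absurd ⟨by linear_combination w * h7 + (d₀ - d₁) * h3, by
        linear_combination w ^ 2 * h8 + (d₀ - d₂) * h3⟩ hd0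
  · right
    have h4 : t₁ = w ^ 2 * t₀ := by
      apply mul_left_cancel₀ n1
      grind
    have h5 : t₂ = w * t₀ := by linear_combination ht - h4 - t₀ * hw
    have h6 : t₀ ≠ 0 := fun h => ht0 ⟨h, by rw [h4, h, mul_zero], by rw [h5, h, mul_zero]⟩
    rcases eq_of_add_eq_zero hw hd₀ (b := w * d₁) (c := w ^ 2 * d₂) (by simp [hnw, hd₁])
      (by simp [hnw, hd₂]) e1 with ⟨h7, h8⟩ | ⟨h7, h8⟩
    · exact absurd ⟨by linear_combination w ^ 2 * h7 + (d₀ - d₁) * h3, by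
        linear_combination w * h8 + (d₀ - d₂) * h3⟩ hd0
    · exact ⟨h6, by linear_combination w ^ 2 * h7 + (w * d₀ - d₁) * h3, by
        linear_combination w * h8 - d₂ * h3, h4, h5⟩
  · refine absurd ⟨?_, ?_⟩ hd0 <;> apply mul_left_cancel₀ n1 <;> grind

theorem eq_of_pow_three {w a : ℂ} (hw : w ^ 2 + w + 1 = 0) (ha : a ^ 3 = 1) :
    a = 1 ∨ a = w ∨ a = w ^ 2 := by
  have h : (a - 1) * ((a - w) * (a - w ^ 2)) = 0 := by
    linear_combination ha + (a - a ^ 2 + w * a - w) * hw + (1 - a) * hw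
  rcases mul_eq_zero.1 h with h | h
  · exact Or.inl (sub_eq_zero.1 h)
  rcases mul_eq_zero.1 h with h | h
  · exact Or.inr (Or.inl (sub_eq_zero.1 h))
  · exact Or.inr (Or.inr (sub_eq_zero.1 h))

/-- Dividing by `c` reduces to `c = 1` and `ab = w`. Then the sum is `2 + w` or `1 + 2w²`, and both
have cube `6w + 3`. -/
theorem add_pow_three {w a b c : ℂ} (hw : w ^ 2 + w + 1 = 0) (ha : a ^ 3 = 1) (hb : b ^ 3 = 1)
    (hc : c ^ 3 = 1) (h : a * b * c = w) : (a + b + c) ^ 3 = 6 * w + 3 := by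
  have h3 : w ^ 3 = 1 := by linear_combination (w - 1) * hw
  have hw1 : w ≠ 1 := fun h => by
    rw [h] at hw
    norm_num at hw
  have key : ∀ x y : ℂ, x ^ 3 = 1 → y ^ 3 = 1 → x * y * (1 : ℂ) = w →
      (x + y + 1) ^ 3 = 6 * w + 3 := by
    intro x y hx hy h
    rcases eq_of_pow_three hw hx with rfl | rfl | rfl
    · grind
    · grind
    · grind
  have hc0 : c ≠ 0 := fun h => by simp [h] at hc
  have h4 := key (a / c) (b / c) (by rw [div_pow, ha, hc, div_one])
    (by rw [div_pow, hb, hc, div_one])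
    (by
      rw [mul_one, div_mul_div_comm, div_eq_iff (mul_ne_zero hc0 hc0), ← h]
      linear_combination -a * b * hc)
  have h5 : (a / c + b / c + 1) ^ 3 = (a + b + c) ^ 3 := by
    rw [show a / c + b / c + 1 = (a + b + c) / c by field_simp, div_pow, hc, div_one]
  rw [← h5, h4]

/-! ### Invariance under equivalence -/

theorem Equivalent.symm {n : Type*} {h h' : Matrix n n ℂ} (e : Equivalent h h') :
    Equivalent h' h := by
  obtain ⟨σ, τ, a, b, e⟩ := e
  refine ⟨σ.symm, τ.symm, fun i => (a (σ.symm i))⁻¹, fun k => (b (τ.symm k))⁻¹, fun i k => ?_⟩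
  rw [e, Equiv.apply_symm_apply, Equiv.apply_symm_apply, Circle.coe_inv, Circle.coe_inv]
  field_simp [Circle.coe_ne_zero]

theorem Equivalent.trans {n : Type*} {h h' h'' : Matrix n n ℂ} (e : Equivalent h h')
    (e' : Equivalent h' h'') : Equivalent h h'' := by
  obtain ⟨σ, τ, a, b, e⟩ := e
  obtain ⟨σ', τ', a', b', e'⟩ := e'
  refine ⟨σ'.trans σ, τ'.trans τ, fun i => a' i * a (σ' i), fun k => b' k * b (τ' k),
    fun i k => ?_⟩
  rw [e', e, Circle.coe_mul, Circle.coe_mul, Equiv.trans_apply, Equiv.trans_apply]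
  ring

theorem Equivalent.of_perm {n : Type*} {h h' : Matrix n n ℂ} (σ τ : Equiv.Perm n)
    (e : ∀ i k, h' i k = h (σ i) (τ k)) : Equivalent h h' :=
  ⟨σ, τ, 1, 1, fun i k => by simp [e]⟩

theorem IsHadamard.of_equivalent {n : Type*} [Fintype n] {h h' : Matrix n n ℂ}
    (hh : IsHadamard h) (e : Equivalent h h') : IsHadamard h' := by
  obtain ⟨σ, τ, a, b, e⟩ := e
  refine ⟨fun i k => by
    rw [e, norm_mul, norm_mul, Circle.norm_coe, Circle.norm_coe, hh.1, one_mul,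
      one_mul], fun i j hij => ?_⟩
  have h1 : ∀ k, h' i k * star (h' j k) =
      a i * star (a j : ℂ) * (h (σ i) (τ k) * star (h (σ j) (τ k))) := fun k => by
    rw [e, e, star_mul', star_mul']
    have := mul_star_of_norm_one (Circle.norm_coe (b k))
    linear_combination (a i * h (σ i) (τ k) * star (a j : ℂ) * star (h (σ j) (τ k))) * this
  rw [Finset.sum_congr rfl fun k _ => h1 k, ← Finset.mul_sum,
    Equiv.sum_comp τ fun k => h (σ i) k * star (h (σ j) k), hh.2 _ _ (σ.injective.ne hij), mul_zero]

/-- Column phases cancel in each term of a scalar product, and row phases contribute one common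
factor, which preserves both the binary and the ternary type. -/
theorem Equivalent.exists_mul_star {h h' : Matrix (Fin 6) (Fin 6) ℂ} (e : Equivalent h h') :
    ∃ (σ τ : Equiv.Perm (Fin 6)) (a : Fin 6 → Fin 6 → Circle), ∀ i j k,
      h' i k * star (h' j k) = a i j * (h (σ i) (τ k) * star (h (σ j) (τ k))) := by
  obtain ⟨σ, τ, a, b, e⟩ := e
  refine ⟨σ, τ, fun i j => a i * (a j)⁻¹, fun i j k => ?_⟩
  rw [e, e, star_mul', star_mul', Circle.coe_mul, Circle.coe_inv_eq_conj, ← Complex.star_def]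
  have := mul_star_of_norm_one (Circle.norm_coe (b k))
  linear_combination (a i * h (σ i) (τ k) * star (a j : ℂ) * star (h (σ j) (τ k))) * this

theorem IsBinary.of_mul_star {u v u' v' : Fin 6 → ℂ} (h : IsBinary u v) (τ : Equiv.Perm (Fin 6))
    (a : Circle) (e : ∀ k, u' k * star (v' k) = a * (u (τ k) * star (v (τ k)))) :
    IsBinary u' v' := by
  obtain ⟨ρ, x, y, z, h⟩ := h
  refine ⟨ρ.trans τ.symm, a * x, a * y, a * z, funext fun k => ?_⟩
  rw [e, Equiv.trans_apply, Equiv.apply_symm_apply, show u (ρ k) * star (v (ρ k)) = _ from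
    congrFun h k]
  fin_cases k <;> simp

theorem IsTernary.of_mul_star {u v u' v' : Fin 6 → ℂ} (h : IsTernary u v)
    (τ : Equiv.Perm (Fin 6)) (a : Circle)
    (e : ∀ k, u' k * star (v' k) = a * (u (τ k) * star (v (τ k)))) : IsTernary u' v' := by
  obtain ⟨ρ, x, y, h⟩ := h
  refine ⟨ρ.trans τ.symm, a * x, a * y, funext fun k => ?_⟩
  rw [e, Equiv.trans_apply, Equiv.apply_symm_apply, show u (ρ k) * star (v (ρ k)) = _ from
    congrFun h k]
  fin_cases k <;> simp [mul_left_comm]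

theorem IsBinary.sum_eq_zero {u v : Fin 6 → ℂ} (h : IsBinary u v) :
    ∑ k, u k * star (v k) = 0 := by
  obtain ⟨σ, x, y, z, h⟩ := h
  rw [← Equiv.sum_comp σ, h]
  simp [Fin.sum_univ_succ]

theorem IsTernary.sum_eq_zero {u v : Fin 6 → ℂ} (h : IsTernary u v) :
    ∑ k, u k * star (v k) = 0 := by
  obtain ⟨σ, x, y, h⟩ := h
  rw [← Equiv.sum_comp σ, h]
  simp [Fin.sum_univ_succ]
  linear_combination (x + y : ℂ) * cubeRoot_sq_add

/-- Complex Hadamard matrices whose scalar products of rows are binary or ternary, both kinds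
occurring. -/
def IsMixed (h : Matrix (Fin 6) (Fin 6) ℂ) : Prop :=
  IsHadamard h ∧
    (∀ i j, i ≠ j → IsBinary (h i) (h j) ∨ IsTernary (h i) (h j)) ∧
    (∃ i j, i ≠ j ∧ IsBinary (h i) (h j)) ∧ (∃ i j, i ≠ j ∧ IsTernary (h i) (h j))

theorem IsMixed.of_equivalent {h h' : Matrix (Fin 6) (Fin 6) ℂ} (hh : IsMixed h)
    (e : Equivalent h h') : IsMixed h' := by
  obtain ⟨h1, h2, ⟨i, j, hij, h3⟩, ⟨k, l, hkl, h4⟩⟩ := hh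
  obtain ⟨σ, τ, a, e'⟩ := e.exists_mul_star
  refine ⟨h1.of_equivalent e, fun i j hij => ?_, ⟨σ.symm i, σ.symm j, σ.symm.injective.ne hij, ?_⟩,
    ⟨σ.symm k, σ.symm l, σ.symm.injective.ne hkl, ?_⟩⟩
  · rcases h2 (σ i) (σ j) (σ.injective.ne hij) with h | h
    · exact Or.inl (h.of_mul_star τ _ (e' i j))
    · exact Or.inr (h.of_mul_star τ _ (e' i j))
  · refine h3.of_mul_star τ _ fun m => by rw [e', Equiv.apply_symm_apply, Equiv.apply_symm_apply]
  · refine h4.of_mul_star τ _ fun m => by rw [e', Equiv.apply_symm_apply, Equiv.apply_symm_apply]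

/-! ### The matrices `F23` and `F32` are mixed -/

theorem fourierMatrix_two : fourierMatrix 2 = !![1, 1; 1, -1] := by
  have h : Complex.exp (2 * Real.pi * Complex.I / (2 : ℕ)) = -1 := by
    rw [← Complex.exp_pi_mul_I]
    congr 1
    push_cast
    ring
  ext i k
  rw [fourierMatrix, Matrix.of_apply, h]
  fin_cases i <;> fin_cases k <;> simp

theorem fourierMatrix_three : fourierMatrix 3 =
    !![1, 1, 1; 1, cubeRoot, cubeRoot ^ 2; 1, cubeRoot ^ 2, cubeRoot] := by
  have h : Complex.exp (2 * Real.pi * Complex.I / (3 : ℕ)) = cubeRoot := rfl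
  have h3 := cubeRoot_pow_three
  ext i k
  rw [fourierMatrix, Matrix.of_apply, h]
  fin_cases i <;> fin_cases k <;> simp
  linear_combination cubeRoot * h3

theorem F23_eq (r s : Circle) : F23 r s =
    !![1, 1, 1, 1, 1, 1;
      1, cubeRoot, cubeRoot ^ 2, r, r * cubeRoot, r * cubeRoot ^ 2;
      1, cubeRoot ^ 2, cubeRoot, s, s * cubeRoot ^ 2, s * cubeRoot;
      1, 1, 1, -1, -1, -1;
      1, cubeRoot, cubeRoot ^ 2, -r, -(r * cubeRoot), -(r * cubeRoot ^ 2);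
      1, cubeRoot ^ 2, cubeRoot, -s, -(s * cubeRoot ^ 2), -(s * cubeRoot)] := by
  ext i k
  rw [F23, fourierMatrix_two, fourierMatrix_three]
  fin_cases i <;> fin_cases k <;>
    simp [ditaDeformation, finProdFinEquiv, Fin.divNat, Fin.modNat]

theorem F32_eq (r s : Circle) : F32 r s =
    !![1, 1, 1, 1, 1, 1;
      1, -1, (r : ℂ), -r, s, -(s : ℂ);
      1, 1, cubeRoot, cubeRoot, cubeRoot ^ 2, cubeRoot ^ 2;
      1, -1, cubeRoot * r, -(cubeRoot * r), cubeRoot ^ 2 * s, -(cubeRoot ^ 2 * s);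
      1, 1, cubeRoot ^ 2, cubeRoot ^ 2, cubeRoot, cubeRoot;
      1, -1, cubeRoot ^ 2 * r, -(cubeRoot ^ 2 * r), cubeRoot * s, -(cubeRoot * s)] := by
  ext i k
  rw [F32, fourierMatrix_two, fourierMatrix_three]
  fin_cases i <;> fin_cases k <;>
    simp [ditaDeformation, finProdFinEquiv, Fin.divNat, Fin.modNat]

theorem isTernary_of_eq {u v : Fin 6 → ℂ} (x y : Circle)
    (h : (∀ k, u k * star (v k) = ![(x : ℂ), cubeRoot * x, cubeRoot ^ 2 * x, y, cubeRoot * y,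
        cubeRoot ^ 2 * y] k) ∨
      ∀ k, u k * star (v k) = ![(x : ℂ), cubeRoot ^ 2 * x, cubeRoot * x, y, cubeRoot ^ 2 * y,
        cubeRoot * y] k) : IsTernary u v := by
  rcases h with h | h
  · exact ⟨1, x, y, funext h⟩
  · refine ⟨(Equiv.swap 1 2).trans (Equiv.swap 4 5), x, y, funext fun k => ?_⟩
    rw [h]
    fin_cases k <;> simp [Equiv.swap_apply_def]

/-- Orthogonality is automatic: binary and ternary sums vanish. -/
theorem isMixed_of_forall {h : Matrix (Fin 6) (Fin 6) ℂ} (h0 : ∀ i k, ‖h i k‖ = 1)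
    (hbt : ∀ i j, i ≠ j → IsBinary (h i) (h j) ∨ IsTernary (h i) (h j))
    (hb : ∃ i j, i ≠ j ∧ IsBinary (h i) (h j)) (ht : ∃ i j, i ≠ j ∧ IsTernary (h i) (h j)) :
    IsMixed h :=
  ⟨⟨h0, fun i j hij => (hbt i j hij).elim (·.sum_eq_zero) (·.sum_eq_zero)⟩, hbt, hb, ht⟩

theorem cubeRoot_pow_eq (n : ℕ) : cubeRoot ^ n = 1 ∧ n % 3 = 0 ∨
    cubeRoot ^ n = cubeRoot ∧ n % 3 = 1 ∨
    cubeRoot ^ n = cubeRoot ^ 2 ∧ n % 3 = 2 := by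
  rw [pow_eq_pow_mod n cubeRoot_pow_three]
  have : n % 3 < 3 := Nat.mod_lt _ (by norm_num)
  interval_cases n % 3 <;> simp

theorem star_coe_circle (z : Circle) : star (z : ℂ) = (z⁻¹ : Circle) := by
  rw [Circle.coe_inv_eq_conj, Complex.star_def]

/-- Row `i` is row `i % 3` of `F_3` followed by the same row times a phase `c i`. Rows congruent mod
3 have opposite phases, giving a binary product; other pairs give a nontrivial character of order
three on each half. -/
theorem isMixed_F23 (r s : Circle) : IsMixed (F23 r s) := by
  have h3 := cubeRoot_pow_three
  obtain ⟨c, hc⟩ : ∃ c : Fin 6 → Circle, c = ![1, r, s, zeta ^ 18, zeta ^ 18 * r, zeta ^ 18 * s] :=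
    ⟨_, rfl⟩
  have happly : ∀ i k : Fin 6, F23 r s i k = (if (k : ℕ) < 3 then 1 else (c i : ℂ)) *
      cubeRoot ^ (((i : ℕ) % 3) * ((k : ℕ) % 3)) := by
    intro i k
    have h4 : cubeRoot ^ 4 = cubeRoot := by linear_combination cubeRoot * h3
    rw [F23_eq, hc]
    fin_cases i <;> fin_cases k <;> simp [coe_zeta_pow_eighteen, h4]
  have hmul : ∀ i j k : Fin 6, F23 r s i k * star (F23 r s j k) =
      (if (k : ℕ) < 3 then 1 else ((c i * (c j)⁻¹ : Circle) : ℂ)) *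
      (cubeRoot ^ ((i : ℕ) % 3 + 2 * ((j : ℕ) % 3))) ^ ((k : ℕ) % 3) := by
    intro i j k
    rw [happly, happly, star_mul', star_pow, star_cubeRoot]
    split_ifs
    · rw [star_one]
      ring
    · rw [star_coe_circle, Circle.coe_mul]
      ring
  have hbt : ∀ i j, i ≠ j → IsBinary (F23 r s i) (F23 r s j) ∧ (i : ℕ) % 3 = (j : ℕ) % 3 ∨
      IsTernary (F23 r s i) (F23 r s j) ∧ (i : ℕ) % 3 ≠ (j : ℕ) % 3 := by
    intro i j hij
    rcases cubeRoot_pow_eq ((i : ℕ) % 3 + 2 * ((j : ℕ) % 3)) with ⟨h, h'⟩ | ⟨h, h'⟩ | ⟨h, h'⟩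
    · have hm : (i : ℕ) % 3 = (j : ℕ) % 3 := by omega
      have hcc : c i = zeta ^ 18 * c j := by
        have h36 : zeta ^ 18 * zeta ^ 18 = 1 := by
          apply Circle.ext
          rw [Circle.coe_mul, Circle.coe_pow, coe_zeta_pow_eighteen]
          simp
        revert hij hm
        rw [hc]
        fin_cases i <;> fin_cases j <;> simp [← mul_assoc, h36]
      refine Or.inl ⟨⟨⟨![0, 3, 1, 4, 2, 5], ![0, 2, 4, 1, 3, 5], by decide, by decide⟩, 1, 1, 1,
        funext fun k => ?_⟩, hm⟩
      rw [hmul, h, one_pow, mul_one, hcc, mul_inv_cancel_right, Circle.coe_pow,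
        coe_zeta_pow_eighteen]
      fin_cases k <;> simp
    · refine Or.inr ⟨isTernary_of_eq 1 (c i * (c j)⁻¹) (Or.inl fun k => ?_), by omega⟩
      rw [hmul, h]
      fin_cases k <;> simp [mul_comm]
    · refine Or.inr ⟨isTernary_of_eq 1 (c i * (c j)⁻¹) (Or.inr fun k => ?_), by omega⟩
      have h4 : (cubeRoot ^ 2) ^ 2 = cubeRoot := by linear_combination cubeRoot * h3
      rw [hmul, h]
      fin_cases k <;> simp [mul_comm, h4]
  refine isMixed_of_forall (fun i k => ?_) (fun i j hij => (hbt i j hij).imp And.left And.left)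
    ⟨0, 3, by decide, (hbt 0 3 (by decide)).elim And.left fun h => absurd rfl h.2⟩
    ⟨0, 1, by decide, (hbt 0 1 (by decide)).elim (fun h => absurd h.2 (by decide)) And.left⟩
  rw [happly, norm_mul, norm_pow, norm_cubeRoot]
  split_ifs <;> simp [Circle.norm_coe]

/-- For rows of the same parity the parameters and signs cancel and a character of order three
remains, each value taken twice; for opposite parity the signs alternate within each pair of
columns. -/
theorem isMixed_F32 (r s : Circle) : IsMixed (F32 r s) := by
  have h3 := cubeRoot_pow_three
  obtain ⟨l, hl⟩ : ∃ l : ℕ → Circle, l 0 = 1 ∧ l 1 = r ∧ l 2 = s :=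
    ⟨fun n => if n = 0 then 1 else if n = 1 then r else s, by simp⟩
  have happly : ∀ i k : Fin 6, F32 r s i k = (l ((k : ℕ) / 2) : ℂ) ^ ((i : ℕ) % 2) *
      (-1) ^ (((i : ℕ) % 2) * ((k : ℕ) % 2)) * cubeRoot ^ (((i : ℕ) / 2) * ((k : ℕ) / 2)) := by
    intro i k
    have h4 : cubeRoot ^ 4 = cubeRoot := by linear_combination cubeRoot * h3
    rw [F32_eq]
    fin_cases i <;> fin_cases k <;> simp [hl, h4, mul_comm]
  have hmul : ∀ i j k : Fin 6, F32 r s i k * star (F32 r s j k) =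
      (l ((k : ℕ) / 2) : ℂ) ^ ((i : ℕ) % 2) * ((l ((k : ℕ) / 2))⁻¹ : Circle) ^ ((j : ℕ) % 2) *
      (-1) ^ (((i : ℕ) % 2 + (j : ℕ) % 2) * ((k : ℕ) % 2)) *
      (cubeRoot ^ ((i : ℕ) / 2 + 2 * ((j : ℕ) / 2))) ^ ((k : ℕ) / 2) := by
    intro i j k
    rw [happly, happly]
    simp only [star_mul', star_pow, star_cubeRoot, star_coe_circle, star_neg, star_one]
    ring
  have hbt : ∀ i j, i ≠ j → IsBinary (F32 r s i) (F32 r s j) ∧ (i : ℕ) % 2 ≠ (j : ℕ) % 2 ∨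
      IsTernary (F32 r s i) (F32 r s j) ∧ (i : ℕ) % 2 = (j : ℕ) % 2 := by
    intro i j hij
    by_cases hm : (i : ℕ) % 2 = (j : ℕ) % 2
    · right
      have hmul' : ∀ k : Fin 6, F32 r s i k * star (F32 r s j k) =
          (cubeRoot ^ ((i : ℕ) / 2 + 2 * ((j : ℕ) / 2))) ^ ((k : ℕ) / 2) := fun k => by
        rw [hmul, hm, ← mul_pow, ← Circle.coe_mul, mul_inv_cancel, Circle.coe_one, one_pow,
          one_mul, ← two_mul, mul_assoc, pow_mul]
        norm_num
      refine ⟨?_, hm⟩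
      rcases cubeRoot_pow_eq ((i : ℕ) / 2 + 2 * ((j : ℕ) / 2)) with ⟨h, h'⟩ | ⟨h, h'⟩ | ⟨h, h'⟩
      · exact absurd (Fin.ext (by omega)) hij
      · refine ⟨⟨![0, 2, 4, 1, 3, 5], ![0, 3, 1, 4, 2, 5], by decide, by decide⟩, 1, 1,
          funext fun k => ?_⟩
        rw [hmul', h]
        fin_cases k <;> simp
      · refine ⟨⟨![0, 4, 2, 1, 5, 3], ![0, 3, 2, 5, 1, 4], by decide, by decide⟩, 1, 1,
          funext fun k => ?_⟩
        have h4 : (cubeRoot ^ 2) ^ 2 = cubeRoot := by linear_combination cubeRoot * h3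
        rw [hmul', h]
        fin_cases k <;> simp [h4]
    · left
      have hmul' : ∃ x : ℕ → Circle, ∀ k : Fin 6, F32 r s i k * star (F32 r s j k) =
          x ((k : ℕ) / 2) * (-1) ^ ((k : ℕ) % 2) := by
        refine ⟨fun n => l n ^ ((i : ℕ) % 2) * (l n)⁻¹ ^ ((j : ℕ) % 2) *
          (omega ^ ((i : ℕ) / 2 + 2 * ((j : ℕ) / 2))) ^ n, fun k => ?_⟩
        rw [hmul, show (i : ℕ) % 2 + (j : ℕ) % 2 = 1 by omega, one_mul]
        simp only [Circle.coe_mul, Circle.coe_pow, coe_omega]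
        ring
      obtain ⟨x, hx⟩ := hmul'
      refine ⟨⟨1, x 0, x 1, x 2, funext fun k => ?_⟩, hm⟩
      rw [hx]
      fin_cases k <;> simp
  refine isMixed_of_forall (fun i k => ?_) (fun i j hij => (hbt i j hij).imp And.left And.left)
    ⟨0, 1, by decide, (hbt 0 1 (by decide)).elim And.left fun h => absurd h.2 (by decide)⟩
    ⟨0, 2, by decide, (hbt 0 2 (by decide)).elim (fun h => absurd rfl h.2) And.left⟩
  rw [happly, norm_mul, norm_mul, norm_pow, norm_pow, norm_pow, norm_cubeRoot, Circle.norm_coe]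
  simp

/-! ### Dephasing and normal form -/

theorem exists_perm_extending {a b c : Fin 6} (hab : b ≠ a) (hac : c ≠ a) (hbc : c ≠ b) :
    ∃ σ : Equiv.Perm (Fin 6), σ 0 = a ∧ σ 1 = b ∧ σ 2 = c := by
  obtain ⟨b', hb'⟩ : ∃ b', b' = Equiv.swap 0 a b := ⟨_, rfl⟩
  have hb0 : b' ≠ 0 := fun h => hab (by
    rw [hb', Equiv.swap_apply_eq_iff, Equiv.swap_apply_left] at h
    exact h)
  obtain ⟨c', hc'⟩ : ∃ c', c' = Equiv.swap 1 b' (Equiv.swap 0 a c) := ⟨_, rfl⟩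
  have hc0 : c' ≠ 0 := fun h => hac (by
    rw [hc', Equiv.swap_apply_eq_iff, Equiv.swap_apply_of_ne_of_ne (by decide) hb0.symm,
      Equiv.swap_apply_eq_iff, Equiv.swap_apply_left] at h
    exact h)
  have hc1 : c' ≠ 1 := fun h => hbc (by
    rw [hc', Equiv.swap_apply_eq_iff, Equiv.swap_apply_left, Equiv.swap_apply_eq_iff, hb',
      Equiv.swap_apply_self] at h
    exact h)
  refine ⟨Equiv.swap 0 a * Equiv.swap 1 b' * Equiv.swap 2 c', ?_, ?_, ?_⟩
  · rw [Equiv.Perm.mul_apply, Equiv.Perm.mul_apply,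
      Equiv.swap_apply_of_ne_of_ne (by decide) hc0.symm,
      Equiv.swap_apply_of_ne_of_ne (by decide) hb0.symm, Equiv.swap_apply_left]
  · rw [Equiv.Perm.mul_apply, Equiv.Perm.mul_apply,
      Equiv.swap_apply_of_ne_of_ne (by decide) hc1.symm,
      Equiv.swap_apply_left, hb', Equiv.swap_apply_self]
  · rw [Equiv.Perm.mul_apply, Equiv.Perm.mul_apply, Equiv.swap_apply_left, hc',
      Equiv.swap_apply_self, Equiv.swap_apply_self]

/-- A complex Hadamard matrix with first row and column equal to one, whose upper left corner is
the Fourier matrix of order three. -/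
structure IsDephased (h : Matrix (Fin 6) (Fin 6) ℂ) : Prop where
  isHadamard : IsHadamard h
  row_zero : ∀ k, h 0 k = 1
  col_zero : ∀ i, h i 0 = 1
  one_one : h 1 1 = cubeRoot
  one_two : h 1 2 = cubeRoot ^ 2
  two_one : h 2 1 = cubeRoot ^ 2
  two_two : h 2 2 = cubeRoot

theorem IsDephased.reindex {h : Matrix (Fin 6) (Fin 6) ℂ} (hh : IsDephased h)
    {σ τ : Equiv.Perm (Fin 6)} (hσ : σ 0 = 0 ∧ σ 1 = 1 ∧ σ 2 = 2)
    (hτ : τ 0 = 0 ∧ τ 1 = 1 ∧ τ 2 = 2) :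
    IsDephased (fun i k => h (σ i) (τ k)) := by
  obtain ⟨h1, h2, h3, h4, h5, h6, h7⟩ := hh
  obtain ⟨s0, s1, s2⟩ := hσ
  obtain ⟨t0, t1, t2⟩ := hτ
  exact ⟨h1.of_equivalent (Equivalent.of_perm σ τ fun _ _ => rfl), fun k => by simp [s0, h2],
    fun i => by simp [t0, h3], by simp [s1, t1, h4], by simp [s1, t2, h5],
    by simp [s2, t1, h6], by simp [s2, t2, h7]⟩

theorem exists_isDephased {h : Matrix (Fin 6) (Fin 6) ℂ} (hh : IsHadamard h)
    {i₀ i₁ i₂ c₀ c₁ c₂ : Fin 6} (h01 : i₀ ≠ i₁) (h20 : i₂ ≠ i₀) (h21 : i₂ ≠ i₁)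
    (e1 : h i₀ c₁ * star (h i₁ c₁) = cubeRoot * (h i₀ c₀ * star (h i₁ c₀)))
    (e2 : h i₀ c₂ * star (h i₁ c₂) = cubeRoot ^ 2 * (h i₀ c₀ * star (h i₁ c₀)))
    (e3 : h i₀ c₁ * star (h i₂ c₁) = cubeRoot ^ 2 * (h i₀ c₀ * star (h i₂ c₀)))
    (e4 : h i₀ c₂ * star (h i₂ c₂) = cubeRoot * (h i₀ c₀ * star (h i₂ c₀))) :
    ∃ h', Equivalent h h' ∧ IsDephased h' := by
  have h3 := cubeRoot_pow_three
  have hone : ∀ i k, h i k * star (h i k) = 1 := fun i k => mul_star_of_norm_one (hh.1 i k)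
  have hne : ∀ i k, h i k ≠ 0 := fun i k h0 => by
    have := hone i k
    simp [h0] at this
  have hne' : ∀ i k, star (h i k) ≠ 0 := fun i k h0 => hne i k (star_eq_zero.1 h0)
  have hw1 : cubeRoot ≠ 1 := isPrimitiveRoot_cubeRoot.ne_one (by norm_num)
  have hc1 : c₁ ≠ c₀ := fun hc => hw1 (by
    rw [hc] at e1
    exact ((right_eq_mul₀ (mul_ne_zero (hne _ _) (hne' _ _))).1 e1))
  have hc2 : c₂ ≠ c₀ := fun hc => hw1 (by
    rw [hc] at e4
    exact ((right_eq_mul₀ (mul_ne_zero (hne _ _) (hne' _ _))).1 e4))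
  have hc3 : c₂ ≠ c₁ := fun hc => hw1 (by
    rw [hc, e1] at e2
    refine mul_left_cancel₀ (mul_ne_zero (isPrimitiveRoot_cubeRoot.ne_zero (by norm_num))
      (mul_ne_zero (hne i₀ c₀) (hne' i₁ c₀))) ?_
    linear_combination -e2)
  -- Row `i₂` comes before `i₁`: the hypotheses bear on conjugates of the entries, so the ratios of
  -- `i₁` and `i₂` themselves are `ω²` and `ω` in the column `c₁`.
  obtain ⟨σ, s0, s1, s2⟩ := exists_perm_extending h20 h01.symm h21.symm
  obtain ⟨τ, t0, t1, t2⟩ := exists_perm_extending hc1 hc2 hc3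
  have hcirc : ∀ i k, ∃ z : Circle, (z : ℂ) = star (h i k) := fun i k =>
    ⟨⟨star (h i k), by simp [Submonoid.unitSphere, hh.1]⟩, rfl⟩
  choose z hz using hcirc
  have heq : Equivalent h fun i k => star (h (σ i) c₀) * h i₀ c₀ * star (h i₀ (τ k)) *
      h (σ i) (τ k) := by
    refine ⟨σ, τ, fun i => z (σ i) c₀ * (z i₀ c₀)⁻¹, fun k => z i₀ (τ k), fun i k => ?_⟩
    rw [Circle.coe_mul, Circle.coe_inv_eq_conj, hz, hz, hz, ← Complex.star_def, star_star]
  refine ⟨_, heq, hh.of_equivalent heq, fun k => ?_, fun i => ?_, ?_, ?_, ?_, ?_⟩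
  · simp only [s0]
    linear_combination h i₀ (τ k) * star (h i₀ (τ k)) * hone i₀ c₀ + hone i₀ (τ k)
  · simp only [t0]
    linear_combination h i₀ c₀ * star (h i₀ c₀) * hone (σ i) c₀ + hone i₀ c₀
  all_goals
    simp only [s1, s2, t1, t2]
    have f1 := congrArg star e1
    have f2 := congrArg star e2
    have f3 := congrArg star e3
    have f4 := congrArg star e4
    simp only [star_mul', star_star, star_pow, star_cubeRoot] at f1 f2 f3 f4
    have g0 := hone i₀ c₀
    have g1 := hone i₁ c₀
    have g2 := hone i₂ c₀
  · linear_combination star (h i₂ c₀) * h i₀ c₀ * f3 + cubeRoot * h3 +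
      cubeRoot ^ 4 * h i₀ c₀ * star (h i₀ c₀) * g2 + cubeRoot ^ 4 * g0
  · linear_combination star (h i₂ c₀) * h i₀ c₀ * f4 +
      cubeRoot ^ 2 * h i₀ c₀ * star (h i₀ c₀) * g2 + cubeRoot ^ 2 * g0
  · linear_combination star (h i₁ c₀) * h i₀ c₀ * f1 +
      cubeRoot ^ 2 * h i₀ c₀ * star (h i₀ c₀) * g1 + cubeRoot ^ 2 * g0
  · linear_combination star (h i₁ c₀) * h i₀ c₀ * f2 + cubeRoot * h3 +
      cubeRoot ^ 4 * h i₀ c₀ * star (h i₀ c₀) * g1 + cubeRoot ^ 4 * g0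

/-- A dephased matrix whose off-diagonal blocks are diagonal multiples of the Fourier matrix. -/
structure IsNormal (h : Matrix (Fin 6) (Fin 6) ℂ) (β γ δ ε : Circle) : Prop extends
    IsDephased h where
  row_one : h 1 3 = β ∧ h 1 4 = cubeRoot * β ∧ h 1 5 = cubeRoot ^ 2 * β
  row_two : h 2 3 = γ ∧ h 2 4 = cubeRoot ^ 2 * γ ∧ h 2 5 = cubeRoot * γ
  col_one : h 3 1 = δ ∧ h 4 1 = cubeRoot * δ ∧ h 5 1 = cubeRoot ^ 2 * δ
  col_two : h 3 2 = ε ∧ h 4 2 = cubeRoot ^ 2 * ε ∧ h 5 2 = cubeRoot * ε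

theorem exists_circle_of_norm_one {z : ℂ} (hz : ‖z‖ = 1) : ∃ c : Circle, z = c :=
  ⟨⟨z, by simp [Submonoid.unitSphere, hz]⟩, rfl⟩

theorem IsDephased.exists_row {h : Matrix (Fin 6) (Fin 6) ℂ} (hh : IsDephased h) :
    ∃ τ : Equiv.Perm (Fin 6), (τ 0 = 0 ∧ τ 1 = 1 ∧ τ 2 = 2) ∧
      h 1 (τ 4) = cubeRoot * h 1 (τ 3) ∧ h 1 (τ 5) = cubeRoot ^ 2 * h 1 (τ 3) := by
  have hn := hh.isHadamard.1
  have h1 := hh.isHadamard.2 1 0 (by decide)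
  simp only [hh.row_zero, star_one, mul_one, Fin.sum_univ_six, hh.col_zero, hh.one_one,
    hh.one_two] at h1
  rcases eq_of_add_eq_zero cubeRoot_sq_add (hn 1 3) (hn 1 4) (hn 1 5)
    (by linear_combination h1 - cubeRoot_sq_add) with h | h
  · exact ⟨1, by decide, h⟩
  · exact ⟨Equiv.swap 4 5, by decide, h.2, h.1⟩

theorem IsDephased.exists_col {h : Matrix (Fin 6) (Fin 6) ℂ} (hh : IsDephased h) :
    ∃ σ : Equiv.Perm (Fin 6), (σ 0 = 0 ∧ σ 1 = 1 ∧ σ 2 = 2) ∧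
      h (σ 4) 1 = cubeRoot * h (σ 3) 1 ∧ h (σ 5) 1 = cubeRoot ^ 2 * h (σ 3) 1 := by
  have hn := hh.isHadamard.1
  have h1 := hh.isHadamard.sum_columns (k := 0) (l := 1) (by decide)
  simp only [hh.row_zero, star_one, one_mul, Fin.sum_univ_six, hh.col_zero, hh.one_one,
    hh.two_one] at h1
  rcases eq_of_add_eq_zero cubeRoot_sq_add (hn 3 1) (hn 4 1) (hn 5 1)
    (by linear_combination h1 - cubeRoot_sq_add) with h | h
  · exact ⟨1, by decide, h⟩
  · exact ⟨Equiv.swap 4 5, by decide, h.2, h.1⟩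

/-- A permutation of the last three columns orients row 1, and one of the last three rows orients
column 1. The orientations of row 2 and column 2 are then forced. -/
theorem IsDephased.exists_isNormal {h : Matrix (Fin 6) (Fin 6) ℂ} (hh : IsDephased h) :
    ∃ h' β γ δ ε, Equivalent h h' ∧ IsNormal h' β γ δ ε := by
  have h3 := cubeRoot_pow_three
  have hw := cubeRoot_sq_add
  obtain ⟨τ, hτ, r1, r2⟩ := hh.exists_row
  obtain ⟨σ, hσ, c1, c2⟩ := hh.exists_col
  have hh' := hh.reindex hσ hτ
  obtain ⟨h', hdef⟩ : ∃ h' : Matrix (Fin 6) (Fin 6) ℂ, h' = fun i k => h (σ i) (τ k) := ⟨_, rfl⟩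
  rw [← hdef] at hh'
  have r1' : h' 1 4 = cubeRoot * h' 1 3 := by simp only [hdef, hσ, r1]
  have r2' : h' 1 5 = cubeRoot ^ 2 * h' 1 3 := by simp only [hdef, hσ, r2]
  have c1' : h' 4 1 = cubeRoot * h' 3 1 := by simp only [hdef, hτ, c1]
  have c2' : h' 5 1 = cubeRoot ^ 2 * h' 3 1 := by simp only [hdef, hτ, c2]
  have hn := hh'.isHadamard.1
  have hone : ∀ i k, h' i k * star (h' i k) = 1 := fun i k => mul_star_of_norm_one (hn i k)
  have hsq : cubeRoot ^ 2 * 3 ≠ 0 := by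
    refine mul_ne_zero (pow_ne_zero _ fun h => ?_) (by norm_num)
    rw [h] at h3
    norm_num at h3
  have row : h' 2 4 = cubeRoot ^ 2 * h' 2 3 ∧ h' 2 5 = cubeRoot * h' 2 3 := by
    have e1 := hh'.isHadamard.2 2 0 (by decide)
    have e2 := hh'.isHadamard.2 2 1 (by decide)
    simp only [hh'.row_zero, star_one, mul_one, Fin.sum_univ_six, hh'.col_zero, hh'.two_one,
      hh'.two_two, hh'.one_one, hh'.one_two, r1', r2', star_mul', star_cubeRoot, star_pow] at e1 e2
    rcases eq_of_add_eq_zero hw (hn 2 3) (hn 2 4) (hn 2 5)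
      (by linear_combination e1 - hw) with h | h
    -- With the same orientation as row 1, the last three terms of the product of rows 1 and 2 would
    -- be equal and nonzero, while the first three already have sum zero.
    · exfalso
      rw [h.1, h.2] at e2
      have g := hone 1 3
      have g' := hone 2 3
      have : star (h' 1 3) * h' 2 3 * 3 = 0 := by
        grind
      have h0 : ∀ i k, h' i k ≠ 0 := fun i k h0 => by
        have := hone i k
        simp [h0] at this
      exact mul_ne_zero (mul_ne_zero (star_ne_zero.2 (h0 _ _)) (h0 _ _)) (by norm_num) this
    · exact h
  have col : h' 4 2 = cubeRoot ^ 2 * h' 3 2 ∧ h' 5 2 = cubeRoot * h' 3 2 := by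
    have e1 := hh'.isHadamard.sum_columns (k := 0) (l := 2) (by decide)
    have e2 := hh'.isHadamard.sum_columns (k := 1) (l := 2) (by decide)
    simp only [hh'.row_zero, star_one, one_mul, Fin.sum_univ_six, hh'.col_zero, hh'.two_one,
      hh'.two_two, hh'.one_one, hh'.one_two, c1', c2', star_mul', star_cubeRoot, star_pow] at e1 e2
    rcases eq_of_add_eq_zero hw (hn 3 2) (hn 4 2) (hn 5 2)
      (by linear_combination e1 - hw) with h | h
    · exfalso
      rw [h.1, h.2] at e2
      have : star (h' 3 1) * h' 3 2 * 3 = 0 := by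
        grind
      have h0 : ∀ i k, h' i k ≠ 0 := fun i k h0 => by
        have := hone i k
        simp [h0] at this
      exact mul_ne_zero (mul_ne_zero (star_ne_zero.2 (h0 _ _)) (h0 _ _)) (by norm_num) this
    · exact h
  obtain ⟨β, hβ⟩ := exists_circle_of_norm_one (hn 1 3)
  obtain ⟨γ, hγ⟩ := exists_circle_of_norm_one (hn 2 3)
  obtain ⟨δ, hδ⟩ := exists_circle_of_norm_one (hn 3 1)
  obtain ⟨ε, hε⟩ := exists_circle_of_norm_one (hn 3 2)
  rw [hβ] at r1' r2'
  rw [hγ] at row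
  rw [hδ] at c1' c2'
  rw [hε] at col
  exact ⟨h', β, γ, δ, ε, Equivalent.of_perm σ τ fun i k => by rw [hdef], hh', ⟨hβ, r1', r2'⟩,
    ⟨hγ, row⟩, ⟨hδ, c1', c2'⟩, ⟨hε, col⟩⟩

/-! ### The circulant system of the lower rows -/

theorem add_pow_three_of_eq {w x a b c : ℂ} (hw : w ^ 2 + w + 1 = 0) (hx : x ≠ 0)
    (ha : a ^ 3 = x ^ 3) (hb : b ^ 3 = x ^ 3) (hc : c ^ 3 = x ^ 3) (h : a * b * c = x ^ 3 * w) :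
    (a + b + c) ^ 3 = x ^ 3 * (6 * w + 3) := by
  have hx3 : x ^ 3 ≠ 0 := pow_ne_zero _ hx
  have h1 := add_pow_three hw (a := a / x) (b := b / x) (c := c / x)
    (by rw [div_pow, ha, div_self hx3]) (by rw [div_pow, hb, div_self hx3])
    (by rw [div_pow, hc, div_self hx3])
    (by rw [div_mul_div_comm, div_mul_div_comm, h]; field_simp)
  rw [← h1]
  field_simp

/-- The values of the discrete Fourier transform in the exceptional case. -/
theorem exists_cube_root_of_circulant {w x₀ x₁ x₂ : ℂ} (hw : w ^ 2 + w + 1 = 0) (hw' : ‖w‖ = 1)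
    (h0 : x₀ * star x₂ ≠ 0) (h1 : x₁ * star x₀ = w * (x₀ * star x₂))
    (h2 : x₂ * star x₁ = w ^ 2 * (x₀ * star x₂)) :
    x₀ ≠ 0 ∧ x₁ ^ 3 = x₀ ^ 3 ∧ x₂ ^ 3 = x₀ ^ 3 ∧ x₀ * x₁ * x₂ = x₀ ^ 3 * w := by
  have hw3 : w ^ 3 = 1 := by linear_combination (w - 1) * hw
  have hx0 : x₀ ≠ 0 := left_ne_zero_of_mul h0
  have hx2 : x₂ ≠ 0 := star_ne_zero.1 (right_ne_zero_of_mul h0)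
  have n1 := congrArg norm h1
  have n2 := congrArg norm h2
  simp only [norm_mul, norm_star, norm_pow, hw', one_pow, one_mul] at n1 n2
  have n3 : ‖x₁‖ = ‖x₂‖ := mul_right_cancel₀ (norm_ne_zero_iff.2 hx0) (by rw [n1, mul_comm])
  have n4 : ‖x₁‖ = ‖x₀‖ := mul_right_cancel₀ (norm_ne_zero_iff.2 hx2) (by rw [← n2, mul_comm])
  obtain ⟨n, hn⟩ : ∃ n : ℂ, n = (‖x₀‖ ^ 2 : ℝ) := ⟨_, rfl⟩
  have hn0 : n ≠ 0 := by
    rw [hn, Complex.ofReal_ne_zero]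
    exact pow_ne_zero _ (norm_ne_zero_iff.2 hx0)
  have m : ∀ z : ℂ, z * star z = (‖z‖ ^ 2 : ℝ) := fun z => by
    rw [Complex.star_def, Complex.mul_conj, Complex.normSq_eq_norm_sq]
  have m0 : x₀ * star x₀ = n := by rw [m, hn]
  have m1 : x₁ * star x₁ = n := by rw [m, hn, n4]
  have m2 : x₂ * star x₂ = n := by rw [m, hn, ← n3, n4]
  -- The three numbers have equal modulus, so `s` is the ratio `x₀ / x₂`. The two relations express
  -- the other ratios by `s`, and going around the cycle gives `s³ = 1`.
  obtain ⟨s, hs⟩ : ∃ s, s = x₀ * star x₂ / n := ⟨_, rfl⟩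
  have e0 : x₀ = s * x₂ := by
    rw [hs, div_mul_eq_mul_div, eq_div_iff hn0]
    linear_combination -x₀ * m2
  have e1 : x₁ = w * s * x₀ := by
    rw [hs, mul_div_assoc', div_mul_eq_mul_div, eq_div_iff hn0]
    linear_combination x₀ * h1 - x₁ * m0
  have e2 : x₂ = w ^ 2 * s * x₁ := by
    rw [hs, mul_div_assoc', div_mul_eq_mul_div, eq_div_iff hn0]
    linear_combination x₁ * h2 - x₂ * m1
  have e3 : x₂ = s ^ 2 * x₀ := by
    rw [e2, e1]
    linear_combination s ^ 2 * x₀ * hw3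
  have hs3 : s ^ 3 = 1 := by
    apply mul_right_cancel₀ hx0
    rw [one_mul]
    conv_rhs => rw [e0, e3]
    ring
  refine ⟨hx0, ?_, ?_, ?_⟩
  · rw [e1]
    linear_combination x₀ ^ 3 * s ^ 3 * hw3 + x₀ ^ 3 * hs3
  · rw [e3]
    linear_combination x₀ ^ 3 * (s ^ 3 + 1) * hs3
  · rw [e3, e1]
    linear_combination x₀ ^ 3 * w * hs3

/-- The terms are cube roots of unity, and `x` and `-x` cannot both be such. -/
theorem not_isBinary_of_forall_pow_three {u v : Fin 6 → ℂ} (hu : ∀ k, u k ^ 3 = 1)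
    (hv : ∀ k, v k ^ 3 = 1) : ¬ IsBinary u v := by
  rintro ⟨σ, x, y, z, h⟩
  have h1 : ∀ k, (u k * star (v k)) ^ 3 = 1 := fun k => by
    rw [mul_pow, ← star_pow, hu, hv, star_one, one_mul]
  have h2 : (x : ℂ) ^ 3 = 1 := by
    rw [← h1 (σ 0), show u (σ 0) * star (v (σ 0)) = _ from congrFun h 0]
    simp
  have h3 : (-x : ℂ) ^ 3 = 1 := by
    rw [← h1 (σ 1), show u (σ 1) * star (v (σ 1)) = _ from congrFun h 1]
    simp
  have h4 : (2 : ℂ) = 0 := by linear_combination -h2 - h3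
  norm_num at h4

/-- Orthogonality to rows 0, 1, 2 says that the last three entries have Fourier transform `-p, -βq,
-γr`. Inversion gives the entries, and their unimodularity gives the first relation. -/
theorem IsNormal.row {h : Matrix (Fin 6) (Fin 6) ℂ} {β γ δ ε : Circle}
    (hh : IsNormal h β γ δ ε) {i : Fin 6} (h0 : i ≠ 0) (h1 : i ≠ 1) (h2 : i ≠ 2) {p q r : ℂ}
    (hp : 1 + h i 1 + h i 2 = p) (hq : 1 + cubeRoot ^ 2 * h i 1 + cubeRoot * h i 2 = q)
    (hr : 1 + cubeRoot * h i 1 + cubeRoot ^ 2 * h i 2 = r) :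
    p * star q * star (β : ℂ) + q * star r * (β * star (γ : ℂ)) + r * star p * γ = 0 ∧
    h i 3 = -(p + β * q + γ * r) / 3 ∧
    h i 4 = -(p + cubeRoot * β * q + cubeRoot ^ 2 * γ * r) / 3 ∧
    h i 5 = -(p + cubeRoot ^ 2 * β * q + cubeRoot * γ * r) / 3 := by
  have hn := hh.isHadamard.1
  have e0 := hh.isHadamard.2 i 0 h0
  have e1 := hh.isHadamard.2 i 1 h1
  have e2 := hh.isHadamard.2 i 2 h2
  have h3 := cubeRoot_pow_three
  have hw := cubeRoot_sq_add
  have hβ := mul_star_of_norm_one (Circle.norm_coe β)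
  have hγ := mul_star_of_norm_one (Circle.norm_coe γ)
  simp only [Fin.sum_univ_six, hh.row_zero, hh.col_zero, hh.one_one, hh.one_two, hh.two_one,
    hh.two_two, hh.row_one.1, hh.row_one.2.1, hh.row_one.2.2, hh.row_two.1, hh.row_two.2.1,
    hh.row_two.2.2, star_one, mul_one, star_mul', star_pow, star_cubeRoot] at e0 e1 e2
  have f0 : h i 3 + h i 4 + h i 5 = -p := by linear_combination e0 - hp
  have f1 : h i 3 + cubeRoot ^ 2 * h i 4 + cubeRoot * h i 5 = -(β * q) := by
    linear_combination β * e1 - β * hq - (h i 3 + cubeRoot ^ 2 * h i 4 + cubeRoot * h i 5) * hβ -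
      (β * h i 2 * cubeRoot + β * h i 5 * star (β : ℂ) * cubeRoot) * h3
  have f2 : h i 3 + cubeRoot * h i 4 + cubeRoot ^ 2 * h i 5 = -(γ * r) := by
    linear_combination γ * e2 - γ * hr - (h i 3 + cubeRoot * h i 4 + cubeRoot ^ 2 * h i 5) * hγ -
      (γ * h i 1 * cubeRoot + γ * h i 4 * star (γ : ℂ) * cubeRoot) * h3
  refine ⟨?_, ?_, ?_, ?_⟩
  · have := fourier_autocorrelation hw star_cubeRoot (hn i 3) (hn i 4) (hn i 5) f0 f1 f2
    simp only [star_neg, star_mul'] at this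
    linear_combination this
  · rw [eq_div_iff (by norm_num)]
    linear_combination f0 + f1 + f2 - (h i 4 + h i 5) * hw
  · rw [eq_div_iff (by norm_num)]
    linear_combination f0 + cubeRoot * f1 + cubeRoot ^ 2 * f2 - (h i 3 + h i 5) * hw -
      (2 * h i 4 + cubeRoot * h i 5) * h3
  · rw [eq_div_iff (by norm_num)]
    linear_combination f0 + cubeRoot ^ 2 * f1 + cubeRoot * f2 - (h i 3 + h i 4) * hw -
      (2 * h i 5 + cubeRoot * h i 4) * h3

/-- Passing to the next lower row multiplies `δ` by `ω` and `ε` by `ω²`, which permutes `x₀, x₁, x₂`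
cyclically. Hence the three relations form a circulant system. -/
theorem IsNormal.rows {h : Matrix (Fin 6) (Fin 6) ℂ} {β γ δ ε : Circle}
    (hh : IsNormal h β γ δ ε) {x₀ x₁ x₂ : ℂ} (h0 : 1 + (δ : ℂ) + ε = x₀)
    (h1 : 1 + cubeRoot * δ + cubeRoot ^ 2 * ε = x₁)
    (h2 : 1 + cubeRoot ^ 2 * δ + cubeRoot * ε = x₂) :
    (x₀ * star x₂ * star (β : ℂ) + x₂ * star x₁ * (β * star (γ : ℂ)) + x₁ * star x₀ * γ = 0 ∧
      h 3 3 = -(x₀ + β * x₂ + γ * x₁) / 3 ∧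
      h 3 4 = -(x₀ + cubeRoot * β * x₂ + cubeRoot ^ 2 * γ * x₁) / 3 ∧
      h 3 5 = -(x₀ + cubeRoot ^ 2 * β * x₂ + cubeRoot * γ * x₁) / 3) ∧
    (x₁ * star x₀ * star (β : ℂ) + x₀ * star x₂ * (β * star (γ : ℂ)) + x₂ * star x₁ * γ = 0 ∧
      h 4 3 = -(x₁ + β * x₀ + γ * x₂) / 3 ∧
      h 4 4 = -(x₁ + cubeRoot * β * x₀ + cubeRoot ^ 2 * γ * x₂) / 3 ∧
      h 4 5 = -(x₁ + cubeRoot ^ 2 * β * x₀ + cubeRoot * γ * x₂) / 3) ∧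
    (x₂ * star x₁ * star (β : ℂ) + x₁ * star x₀ * (β * star (γ : ℂ)) + x₀ * star x₂ * γ = 0 ∧
      h 5 3 = -(x₂ + β * x₁ + γ * x₀) / 3 ∧
      h 5 4 = -(x₂ + cubeRoot * β * x₁ + cubeRoot ^ 2 * γ * x₀) / 3 ∧
      h 5 5 = -(x₂ + cubeRoot ^ 2 * β * x₁ + cubeRoot * γ * x₀) / 3) := by
  have h3 := cubeRoot_pow_three
  obtain ⟨c3, c4, c5⟩ := hh.col_one
  obtain ⟨d3, d4, d5⟩ := hh.col_two
  refine ⟨hh.row (i := 3) (by decide) (by decide) (by decide) ?_ ?_ ?_,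
    hh.row (i := 4) (by decide) (by decide) (by decide) ?_ ?_ ?_,
    hh.row (i := 5) (by decide) (by decide) (by decide) ?_ ?_ ?_⟩
  · rw [c3, d3, h0]
  · rw [c3, d3, h2]
  · rw [c3, d3, h1]
  · rw [c4, d4, h1]
  · rw [c4, d4]
    linear_combination h0 + (δ + ε : ℂ) * h3
  · rw [c4, d4]
    linear_combination h2 + cubeRoot * ε * h3
  · rw [c5, d5, h2]
  · rw [c5, d5]
    linear_combination h1 + cubeRoot * δ * h3
  · rw [c5, d5]
    linear_combination h0 + (δ + ε : ℂ) * h3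

/-! ### The three solutions of the circulant system -/

theorem IsNormal.equivalent_F23 {h : Matrix (Fin 6) (Fin 6) ℂ} {β γ δ ε : Circle}
    (hh : IsNormal h β γ δ ε) (σ : Equiv.Perm (Fin 6)) (hσ : σ 0 = 0 ∧ σ 1 = 1 ∧ σ 2 = 2)
    (h3 : ∀ k, h (σ 3) k = ![1, 1, 1, -1, -1, -1] k)
    (h4 : ∀ k, h (σ 4) k = ![1, cubeRoot, cubeRoot ^ 2, -β, -(β * cubeRoot),
      -(β * cubeRoot ^ 2)] k)
    (h5 : ∀ k, h (σ 5) k = ![1, cubeRoot ^ 2, cubeRoot, -γ, -(γ * cubeRoot ^ 2),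
      -(γ * cubeRoot)] k) :
    Equivalent h (F23 β γ) := by
  obtain ⟨s0, s1, s2⟩ := hσ
  refine Equivalent.of_perm σ 1 fun i k => ?_
  rw [F23_eq, Equiv.Perm.one_apply]
  fin_cases i
  · fin_cases k <;> simp [s0, hh.row_zero]
  · fin_cases k <;> simp [s1, hh.col_zero, hh.one_one, hh.one_two, hh.row_one, mul_comm]
  · fin_cases k <;> simp [s2, hh.col_zero, hh.two_one, hh.two_two, hh.row_two, mul_comm]
  · exact (h3 k).symm
  · exact (h4 k).symm
  · exact (h5 k).symm

theorem IsNormal.equivalent_F32 {h : Matrix (Fin 6) (Fin 6) ℂ} {β γ δ ε : Circle}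
    (hh : IsNormal h β γ δ ε) (τ : Equiv.Perm (Fin 6)) (hτ : τ 0 = 0 ∧ τ 2 = 1 ∧ τ 4 = 2)
    (h1 : ∀ i, h i (τ 1) = ![1, 1, 1, -1, -1, -1] i * h i 0)
    (h2 : ∀ i, h i (τ 3) = ![1, 1, 1, -1, -1, -1] i * h i 1)
    (h3 : ∀ i, h i (τ 5) = ![1, 1, 1, -1, -1, -1] i * h i 2) :
    Equivalent h (F32 δ ε) := by
  obtain ⟨t0, t1, t2⟩ := hτ
  refine Equivalent.of_perm ⟨![0, 3, 1, 4, 2, 5], ![0, 2, 4, 1, 3, 5], by decide, by decide⟩ τ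
    fun i k => ?_
  rw [F32_eq]
  fin_cases k
  · fin_cases i <;> simp [t0, hh.col_zero]
  · fin_cases i <;> simp [h1, hh.col_zero]
  · fin_cases i <;> simp [t1, hh.row_zero, hh.one_one, hh.two_one, hh.col_one]
  · fin_cases i <;> simp [h2, hh.row_zero, hh.one_one, hh.two_one, hh.col_one]
  · fin_cases i <;> simp [t2, hh.row_zero, hh.one_two, hh.two_two, hh.col_two]
  · fin_cases i <;> simp [h3, hh.row_zero, hh.one_two, hh.two_two, hh.col_two]

/-- Two of the `x`'s vanish and the third is 3, since their sum is 3. So `δ, ε` are cube roots of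
unity, the lower left block is `F_3` with its rows shifted cyclically, and the nonzero `x` tells the
shift. -/
theorem IsNormal.exists_equivalent_F23 {h : Matrix (Fin 6) (Fin 6) ℂ} {β γ δ ε : Circle}
    (hh : IsNormal h β γ δ ε) {x₀ x₁ x₂ : ℂ} (h0 : 1 + (δ : ℂ) + ε = x₀)
    (h1 : 1 + cubeRoot * δ + cubeRoot ^ 2 * ε = x₁)
    (h2 : 1 + cubeRoot ^ 2 * δ + cubeRoot * ε = x₂)
    (hx : x₀ * star x₂ = 0 ∧ x₁ * star x₀ = 0 ∧ x₂ * star x₁ = 0) :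
    Equivalent h (F23 β γ) := by
  have hw := cubeRoot_sq_add
  have w3 := cubeRoot_pow_three
  have w4 : cubeRoot ^ 4 = cubeRoot := by linear_combination cubeRoot * w3
  obtain ⟨⟨-, a3, a4, a5⟩, ⟨-, b3, b4, b5⟩, ⟨-, c3, c4, c5⟩⟩ := hh.rows h0 h1 h2
  have hs : x₀ + x₁ + x₂ = 3 := by linear_combination -h0 - h1 - h2 + (δ + ε : ℂ) * hw
  have hd : (δ : ℂ) = (x₀ + cubeRoot ^ 2 * x₁ + cubeRoot * x₂) / 3 := by
    rw [eq_div_iff (by norm_num)]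
    linear_combination h0 + cubeRoot ^ 2 * h1 + cubeRoot * h2 -
      (1 + (ε : ℂ)) * hw - (2 * δ + cubeRoot * ε : ℂ) * w3
  have he : (ε : ℂ) = (x₀ + cubeRoot * x₁ + cubeRoot ^ 2 * x₂) / 3 := by
    rw [eq_div_iff (by norm_num)]
    linear_combination h0 + cubeRoot * h1 + cubeRoot ^ 2 * h2 -
      (1 + (δ : ℂ)) * hw - (2 * ε + cubeRoot * δ : ℂ) * w3
  obtain ⟨e1, e2, e3⟩ := hx
  simp only [mul_eq_zero, star_eq_zero] at e1 e2 e3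
  have key : (x₁ = 0 ∧ x₂ = 0) ∨ (x₀ = 0 ∧ x₂ = 0) ∨ (x₀ = 0 ∧ x₁ = 0) := by tauto
  rcases key with ⟨z, z'⟩ | ⟨z, z'⟩ | ⟨z, z'⟩
  · have z0 : x₀ = 3 := by linear_combination hs - z - z'
    rw [z, z', z0] at hd he a3 a4 a5 b3 b4 b5 c3 c4 c5
    norm_num at hd he a3 a4 a5 b3 b4 b5 c3 c4 c5
    refine hh.equivalent_F23 1 (by decide) (fun k => ?_) (fun k => ?_) fun k => ?_
    · fin_cases k <;> simp [hh.col_zero, hh.col_one, hh.col_two, hd, he, a3, a4, a5]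
    · fin_cases k <;> simp [hh.col_zero, hh.col_one, hh.col_two, hd, he, b3, b4, b5] <;> ring
    · fin_cases k <;> simp [hh.col_zero, hh.col_one, hh.col_two, hd, he, c3, c4, c5] <;> ring
  · have z0 : x₁ = 3 := by linear_combination hs - z - z'
    rw [z, z', z0] at hd he a3 a4 a5 b3 b4 b5 c3 c4 c5
    norm_num at hd he a3 a4 a5 b3 b4 b5 c3 c4 c5
    refine hh.equivalent_F23 ⟨![0, 1, 2, 4, 5, 3], ![0, 1, 2, 5, 3, 4], by decide, by decide⟩
      (by decide) (fun k => ?_) (fun k => ?_) fun k => ?_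
    · fin_cases k <;> simp [hh.col_zero, hh.col_one, hh.col_two, hd, he, b3, b4, b5] <;> grind
    · fin_cases k <;> simp [hh.col_zero, hh.col_one, hh.col_two, hd, he, c3, c4, c5] <;> grind
    · fin_cases k <;> simp [hh.col_zero, hh.col_one, hh.col_two, hd, he, a3, a4, a5] <;> grind
  · have z0 : x₂ = 3 := by linear_combination hs - z - z'
    rw [z, z', z0] at hd he a3 a4 a5 b3 b4 b5 c3 c4 c5
    norm_num at hd he a3 a4 a5 b3 b4 b5 c3 c4 c5
    refine hh.equivalent_F23 ⟨![0, 1, 2, 5, 3, 4], ![0, 1, 2, 4, 5, 3], by decide, by decide⟩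
      (by decide) (fun k => ?_) (fun k => ?_) fun k => ?_
    · fin_cases k <;> simp [hh.col_zero, hh.col_one, hh.col_two, hd, he, c3, c4, c5] <;> grind
    · fin_cases k <;> simp [hh.col_zero, hh.col_one, hh.col_two, hd, he, a3, a4, a5] <;> grind
    · fin_cases k <;> simp [hh.col_zero, hh.col_one, hh.col_two, hd, he, b3, b4, b5] <;> grind

/-- The hypotheses force `β³ = 1` and `γ = β²`, so the upper right block is `F_3` with its columns
shifted cyclically. Each of the last three columns then agrees with one of the first three in the
upper half and is opposite to it below. -/
theorem IsNormal.exists_equivalent_F32 {h : Matrix (Fin 6) (Fin 6) ℂ} {β γ δ ε : Circle}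
    (hh : IsNormal h β γ δ ε) (h1 : (β : ℂ) * star (γ : ℂ) = star (β : ℂ))
    (h2 : (γ : ℂ) = star (β : ℂ)) : Equivalent h (F32 δ ε) := by
  have hw := cubeRoot_sq_add
  have w3 := cubeRoot_pow_three
  have w4 : cubeRoot ^ 4 = cubeRoot := by linear_combination cubeRoot * w3
  obtain ⟨⟨-, a3, a4, a5⟩, ⟨-, b3, b4, b5⟩, ⟨-, c3, c4, c5⟩⟩ := hh.rows rfl rfl rfl
  have hβ := mul_star_of_norm_one (Circle.norm_coe β)
  have hb3 : (β : ℂ) ^ 3 = 1 := by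
    rw [h2, star_star] at h1
    linear_combination hβ + β * h1
  have hg : (γ : ℂ) = β ^ 2 := by
    rw [h2, star_star] at h1
    rw [h2]
    linear_combination -h1
  rcases eq_of_pow_three hw hb3 with hb | hb | hb <;> rw [hb] at hg <;>
    rw [hb, hg] at a3 a4 a5 b3 b4 b5 c3 c4 c5
  · refine hh.equivalent_F32 ⟨![0, 3, 1, 4, 2, 5], ![0, 2, 4, 1, 3, 5], by decide, by decide⟩
      (by decide) (fun i => ?_) (fun i => ?_) fun i => ?_ <;>
    fin_cases i <;> simp [hh.row_zero, hh.col_zero, hh.one_one, hh.one_two, hh.two_one, hh.two_two,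
      hh.row_one, hh.row_two, hh.col_one, hh.col_two, hb, hg, a3, a4, a5, b3, b4, b5, c3, c4,
      c5] <;>
    grind
  · refine hh.equivalent_F32 ⟨![0, 5, 1, 3, 2, 4], ![0, 2, 4, 3, 5, 1], by decide, by decide⟩
      (by decide) (fun i => ?_) (fun i => ?_) fun i => ?_ <;>
    fin_cases i <;> simp [hh.row_zero, hh.col_zero, hh.one_one, hh.one_two, hh.two_one, hh.two_two,
      hh.row_one, hh.row_two, hh.col_one, hh.col_two, hb, hg, a3, a4, a5, b3, b4, b5, c3, c4,
      c5] <;>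
    grind
  · refine hh.equivalent_F32 ⟨![0, 4, 1, 5, 2, 3], ![0, 2, 4, 5, 1, 3], by decide, by decide⟩
      (by decide) (fun i => ?_) (fun i => ?_) fun i => ?_ <;>
    fin_cases i <;> simp [hh.row_zero, hh.col_zero, hh.one_one, hh.one_two, hh.two_one, hh.two_two,
      hh.row_one, hh.row_two, hh.col_one, hh.col_two, hb, hg, a3, a4, a5, b3, b4, b5, c3, c4,
      c5] <;>
    grind

theorem neg_add_div_pow_three {v x a b c : ℂ} (hv : v ^ 2 + v + 1 = 0) (hx : x ≠ 0)
    (h27 : x ^ 3 * (6 * v + 3) = 27) (ha : a ^ 3 = x ^ 3) (hb : b ^ 3 = x ^ 3)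
    (hc : c ^ 3 = x ^ 3) (h : a * b * c = x ^ 3 * v ^ 2) : (-(a + b + c) / 3) ^ 3 = 1 := by
  have h1 := add_pow_three_of_eq (w := v ^ 2) (by linear_combination (v ^ 2 - v + 1) * hv) hx ha hb
    hc h
  rw [div_pow, neg_pow, h1, div_eq_iff (by norm_num)]
  linear_combination h27 - 6 * x ^ 3 * hv

/-- The geometric case, where `v` is either primitive cube root of unity. The `x`'s have equal cubes
and a prescribed product, as do the three summands of each entry in the lower right block, so
`add_pow_three_of_eq` computes the cubes of all these sums. -/
theorem IsNormal.pow_three_eq_one {h : Matrix (Fin 6) (Fin 6) ℂ} {β γ δ ε : Circle}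
    (hh : IsNormal h β γ δ ε) {x₀ x₁ x₂ v : ℂ} (h0 : 1 + (δ : ℂ) + ε = x₀)
    (h1 : 1 + cubeRoot * δ + cubeRoot ^ 2 * ε = x₁)
    (h2 : 1 + cubeRoot ^ 2 * δ + cubeRoot * ε = x₂) (hv : v ^ 2 + v + 1 = 0) (hv' : ‖v‖ = 1)
    (ht : x₀ * star x₂ ≠ 0) (hd₁ : β * star (γ : ℂ) = v ^ 2 * star (β : ℂ))
    (hd₂ : (γ : ℂ) = v * star (β : ℂ)) (ht₁ : x₁ * star x₀ = v * (x₀ * star x₂))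
    (ht₂ : x₂ * star x₁ = v ^ 2 * (x₀ * star x₂)) (i k : Fin 6) : h i k ^ 3 = 1 := by
  have hw := cubeRoot_sq_add
  have w3 := cubeRoot_pow_three
  have v3 : v ^ 3 = 1 := by linear_combination (v - 1) * hv
  obtain ⟨⟨-, a3, a4, a5⟩, ⟨-, b3, b4, b5⟩, ⟨-, c3, c4, c5⟩⟩ := hh.rows h0 h1 h2
  obtain ⟨hx, k1, k2, kp⟩ := exists_cube_root_of_circulant hv hv' ht ht₁ ht₂
  have hβ := mul_star_of_norm_one (Circle.norm_coe β)
  have hγ := mul_star_of_norm_one (Circle.norm_coe γ)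
  have hbg : (β : ℂ) * γ = v := by linear_combination β * hd₂ + v * hβ
  have hb2 : (β : ℂ) ^ 2 = v ^ 2 * γ := by
    linear_combination β * γ * hd₁ - β ^ 2 * hγ + v ^ 2 * γ * hβ
  have hb : (β : ℂ) ^ 3 = 1 := by linear_combination β * hb2 + v ^ 2 * hbg + v3
  have hg : (γ : ℂ) ^ 3 = 1 := by
    have : ((β : ℂ) * γ) ^ 3 = v ^ 3 := by rw [hbg]
    rw [mul_pow, hb, v3, one_mul] at this
    exact this
  -- The condition `x₀ + x₁ + x₂ = 3` fixes the common cube of the `x`'s; the twisted sums, equal to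
  -- `3δ` and `3ε`, have the same cube 27.
  have h27 : x₀ ^ 3 * (6 * v + 3) = 27 := by
    rw [← add_pow_three_of_eq hv hx rfl k1 k2 kp]
    rw [show x₀ + x₁ + x₂ = 3 by linear_combination -h0 - h1 - h2 + (δ + ε : ℂ) * hw]
    norm_num
  have p2 : (cubeRoot ^ 2) ^ 3 = 1 := by linear_combination (cubeRoot ^ 3 + 1) * w3
  have hd : (δ : ℂ) ^ 3 = 1 := by
    have h3 := add_pow_three_of_eq hv hx rfl (b := cubeRoot ^ 2 * x₁) (c := cubeRoot * x₂)
      (by rw [mul_pow, p2, k1, one_mul]) (by rw [mul_pow, w3, k2, one_mul])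
      (by linear_combination kp + x₀ * x₁ * x₂ * w3)
    rw [h27, show x₀ + cubeRoot ^ 2 * x₁ + cubeRoot * x₂ = 3 * δ by
      linear_combination -h0 - cubeRoot ^ 2 * h1 - cubeRoot * h2 +
        (1 + (ε : ℂ)) * hw + (2 * δ + cubeRoot * ε : ℂ) * w3] at h3
    linear_combination h3 / 27
  have he : (ε : ℂ) ^ 3 = 1 := by
    have h3 := add_pow_three_of_eq hv hx rfl (b := cubeRoot * x₁) (c := cubeRoot ^ 2 * x₂)
      (by rw [mul_pow, w3, k1, one_mul]) (by rw [mul_pow, p2, k2, one_mul])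
      (by linear_combination kp + x₀ * x₁ * x₂ * w3)
    rw [h27, show x₀ + cubeRoot * x₁ + cubeRoot ^ 2 * x₂ = 3 * ε by
      linear_combination -h0 - cubeRoot * h1 - cubeRoot ^ 2 * h2 +
        (1 + (δ : ℂ)) * hw + (2 * ε + cubeRoot * δ : ℂ) * w3] at h3
    linear_combination h3 / 27
  have key : ∀ {a b c y z : ℂ}, a ^ 3 = x₀ ^ 3 → b ^ 3 = x₀ ^ 3 → c ^ 3 = x₀ ^ 3 →
      a * b * c = x₀ ^ 3 * v → y ^ 3 = 1 → z ^ 3 = 1 → y * z = 1 →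
      (-(a + y * β * b + z * γ * c) / 3) ^ 3 = 1 := by
    intro a b c y z ha hb' hc hp hy hz hyz
    refine neg_add_div_pow_three hv hx h27 ha ?_ ?_ ?_
    · rw [mul_pow, mul_pow, hy, hb, hb', one_mul, one_mul]
    · rw [mul_pow, mul_pow, hz, hg, hc, one_mul, one_mul]
    · linear_combination a * b * c * β * γ * hyz + a * b * c * hbg + v * hp
  have key' : ∀ {a b c : ℂ}, a ^ 3 = x₀ ^ 3 → b ^ 3 = x₀ ^ 3 → c ^ 3 = x₀ ^ 3 →
      a * b * c = x₀ ^ 3 * v → (-(a + β * b + γ * c) / 3) ^ 3 = 1 := by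
    intro a b c ha hb' hc hp
    have := key ha hb' hc hp (one_pow 3) (one_pow 3) (mul_one 1)
    rwa [one_mul, one_mul] at this
  have q1 : x₀ * x₂ * x₁ = x₀ ^ 3 * v := by linear_combination kp
  have q2 : x₁ * x₀ * x₂ = x₀ ^ 3 * v := by linear_combination kp
  have q3 : x₂ * x₁ * x₀ = x₀ ^ 3 * v := by linear_combination kp
  have y1 : cubeRoot * cubeRoot ^ 2 = 1 := by linear_combination w3
  have y2 : cubeRoot ^ 2 * cubeRoot = 1 := by linear_combination w3
  fin_cases i <;> fin_cases k <;>
    simp only [Fin.zero_eta, Fin.mk_one, Fin.reduceFinMk, hh.row_zero, hh.col_zero, hh.one_one,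
      hh.one_two, hh.two_one, hh.two_two, hh.row_one, hh.row_two, hh.col_one, hh.col_two, mul_pow,
      p2, w3, hb, hg, hd, he, one_mul, one_pow]
  · rw [a3]; exact key' rfl k2 k1 q1
  · rw [a4]; exact key rfl k2 k1 q1 w3 p2 y1
  · rw [a5]; exact key rfl k2 k1 q1 p2 w3 y2
  · rw [b3]; exact key' k1 rfl k2 q2
  · rw [b4]; exact key k1 rfl k2 q2 w3 p2 y1
  · rw [b5]; exact key k1 rfl k2 q2 p2 w3 y2
  · rw [c3]; exact key' k2 k1 rfl q3
  · rw [c4]; exact key k2 k1 rfl q3 w3 p2 y1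
  · rw [c5]; exact key k2 k1 rfl q3 p2 w3 y2

theorem IsNormal.equivalent_of_isMixed {h : Matrix (Fin 6) (Fin 6) ℂ} {β γ δ ε : Circle}
    (hh : IsNormal h β γ δ ε) (hm : IsMixed h) :
    Equivalent h (F23 β γ) ∨ Equivalent h (F32 δ ε) := by
  have hw := cubeRoot_sq_add
  have w3 := cubeRoot_pow_three
  obtain ⟨-, -, ⟨i, j, -, hb⟩, -⟩ := hm
  obtain ⟨⟨e0, -⟩, ⟨e1, -⟩, ⟨e2, -⟩⟩ := hh.rows rfl rfl rfl
  -- Applied to `(1, δ, ε)`, the autocorrelation relation is the vanishing of the row sum of the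
  -- circulant.
  have ht := fourier_autocorrelation hw star_cubeRoot norm_one (Circle.norm_coe δ)
    (Circle.norm_coe ε) rfl rfl rfl
  rcases circulant_kernel hw (by linear_combination ht) e0 e1 e2
    (by rw [norm_star, Circle.norm_coe])
    (by rw [norm_mul, norm_star, Circle.norm_coe, Circle.norm_coe, one_mul])
    (Circle.norm_coe γ) with
    hx | ⟨d1, d2⟩ | ⟨t0, d1, d2, t1, t2⟩ | ⟨t0, d1, d2, t1, t2⟩
  · exact Or.inl (hh.exists_equivalent_F23 rfl rfl rfl hx)
  · exact Or.inr (hh.exists_equivalent_F32 d1 d2)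
  · have h3 := hh.pow_three_eq_one rfl rfl rfl hw norm_cubeRoot t0 d1 d2 t1 t2
    exact absurd hb (not_isBinary_of_forall_pow_three (h3 i) (h3 j))
  · have w4 : (cubeRoot ^ 2) ^ 2 = cubeRoot := by linear_combination cubeRoot * w3
    have h3 := hh.pow_three_eq_one (v := cubeRoot ^ 2) rfl rfl rfl (by rw [w4, ← hw]; ring)
      (by rw [norm_pow, norm_cubeRoot, one_pow]) t0 (by rw [w4, d1]) d2 t1 (by rw [w4, t2])
    exact absurd hb (not_isBinary_of_forall_pow_three (h3 i) (h3 j))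

theorem IsMixed.exists_equivalent {h : Matrix (Fin 6) (Fin 6) ℂ} (hm : IsMixed h) :
    ∃ r s : Circle, Equivalent h (F23 r s) ∨ Equivalent h (F32 r s) := by
  obtain ⟨i₀, i₁, hi, ht⟩ := hm.2.2.2
  obtain ⟨i₂, c₀, c₁, c₂, h20, h21, e1, e2, e3, e4⟩ := exists_fourier_submatrix hm.1 hm.2.1 hi ht
  obtain ⟨h', e, hd⟩ := exists_isDephased hm.1 hi h20 h21 e1 e2 e3 e4
  obtain ⟨h'', β, γ, δ, ε, e', hn⟩ := hd.exists_isNormal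
  have e'' := e.trans e'
  rcases hn.equivalent_of_isMixed (hm.of_equivalent e'') with h | h
  · exact ⟨β, γ, Or.inl (e''.trans h)⟩
  · exact ⟨δ, ε, Or.inr (e''.trans h)⟩

end ComplexHadamard

theorem theorem10p5 (h : Matrix (Fin 6) (Fin 6) ℂ) :
    (ComplexHadamard.IsHadamard h ∧
      (∀ i j, i ≠ j → ComplexHadamard.IsBinary (h i) (h j) ∨ ComplexHadamard.IsTernary (h i) (h j)) ∧
      (∃ i j, i ≠ j ∧ ComplexHadamard.IsBinary (h i) (h j)) ∧
      (∃ i j, i ≠ j ∧ ComplexHadamard.IsTernary (h i) (h j))) ↔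
    ∃ r s : Circle,
      ComplexHadamard.Equivalent h (ComplexHadamard.F23 r s) ∨
        ComplexHadamard.Equivalent h (ComplexHadamard.F32 r s) := by
  refine ⟨fun hm => ComplexHadamard.IsMixed.exists_equivalent hm, ?_⟩
  rintro ⟨r, s, e | e⟩
  · exact (ComplexHadamard.isMixed_F23 r s).of_equivalent e.symm
  · exact (ComplexHadamard.isMixed_F32 r s).of_equivalent e.symm
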